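/- Let $q=2^h$, $h\ge 1$, and let $\mathrm{Tr}$ be the trace from $\mathbb F_q$ to $\mathbb F_2$. Represent a point $P=(y_0,\dots,y_5)$ of $\mathrm{PG}(5,q)$ by the symmetric matrix $$M_P=\begin{bmatrix}y_0&y_1&y_2\\y_1&y_3&y_4\\y_2&y_4&y_5\end{bmatrix},$$ and call the rank of $M_P$ the rank of $P$. Let $\mathcal V(\mathbb F_q)$ be the Veronese surface, the image of $\nu:\mathrm{PG}(2,q)\to\mathrm{PG}(5,q)$, $(u_0,u_1,u_2)\mapsto(u_0^2,u_0u_1,u_0u_2,u_1^2,u_1u_2,u_2^2)$; let $\pi_{\mathcal N}=\mathcal Z(Y_0,Y_3,Y_5)$ be the nucleus plane, and let $K\cong\mathrm{PGL}(3,q)$ be the group of projectivities $M_P\mapsto AM_PA^T$, $A\in\mathrm{GL}(3,q)$, of $\mathrm{PG}(5,q)$. The conics of $\mathcal V(\mathbb F_q)$ are the images under $\nu$ of the lines of $\mathrm{PG}(2,q)$; the span of such a conic is its conic plane. Let $\mathcal H_1$ be the set of hyperplanes of $\mathrm{PG}(5,q)$ corresponding to double lines $(w_0X_0+w_1X_1+w_2X_2)^2=0$,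 $(w_0,w_1,w_2)\ne 0$, of $\mathrm{PG}(2,q)$, where the conic $\sum_{i\le j}a_{ij}X_iX_j=0$ corresponds to the hyperplane $a_{00}Y_0+a_{01}Y_1+a_{02}Y_2+a_{11}Y_3+a_{12}Y_4+a_{22}Y_5=0$. For a point $P\in\pi_{\mathcal N}$ let $\mathcal C(P)$ be the unique conic of $\mathcal V(\mathbb F_q)$ whose conic plane contains $P$, and let $H(P)$ be the unique hyperplane in $\mathcal H_1$ containing $\mathcal C(P)$. If a plane $\pi$ is disjoint from $\mathcal V(\mathbb F_q)$ and meets $\pi_{\mathcal N}$ in a single point, let $H(\pi)$ be the unique hyperplane in $\mathcal H_1$ containing $\pi$. For a subspace $W$ let $OD_0(W)=[r_1,r_{2,n},r_{2,s},r_3]$, where $r_1$ and $r_3$ are the numbers of points of rank $1$ and $3$ in $W$, and $r_{2,n}$ and $r_{2,s}$ are the numbers of points of rank $2$ in $W$ that lie in $\pi_{\mathcal N}$ and outside $\pi_{\mathcal N}$ respectively. Let $\Sigma_{18}$, $\Sigma_{19}$, $\Sigma_{20}$ be the sets of planes that are $K$-equivalent to a plane represented (as $(x,y,z)$ varies) by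 $$\begin{bmatrix}x&y&z\\y&cz&x+z\\z&x+z&0\end{bmatrix},\qquad \begin{bmatrix}x&y&0\\y&y+z&z\\0&z&x\end{bmatrix},\qquad \begin{bmatrix}x&y&bx\\y&cx+y+z&z\\bx&z&x\end{bmatrix}$$ respectively, where in the first matrix $c\in\mathbb F_q$ is such that $X^3+X+c$ has no root in $\mathbb F_q$ and $\mathrm{Tr}(c^{-1})=\mathrm{Tr}(1)$, and in the third $b,c\in\mathbb F_q$, $b\neq 1$ and $\mathrm{Tr}(c/(1+b^2))=1$. **Theorem.** Each of $\Sigma_{18},\Sigma_{19},\Sigma_{20}$ is a single $K$-orbit of planes (in particular non-empty and independent of the choice of the parameters), and the three orbits are pairwise distinct. A plane $\pi$ of $\mathrm{PG}(5,q)$ is disjoint from $\mathcal V(\mathbb F_q)$, meets $\pi_{\mathcal N}$ in exactly one point $P$ and satisfies $H(P)=H(\pi)$ if and only if it belongs to $\Sigma_{18}\cup\Sigma_{19}\cup\Sigma_{20}$. Moreover every plane in $\Sigma_{18}$, $\Sigma_{19}$, $\Sigma_{20}$ has $OD_0$ equal to $[0,1,0,q^2+q]$, $[0,1,3q,q^2-2q]$,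 $[0,1,q,q^2]$ respectively. -/

import Mathlib

open Module
open scoped LinearAlgebra.Projectivization Matrix

noncomputable section

namespace VeronesePlanes

variable {F : Type*} [Field F]

/-- The coordinate space of `PG(5,q)`, with coordinates `(y₀, …, y₅)`. -/
abbrev V6 (F : Type*) : Type _ := Fin 6 → F

/-- The coordinate space of `PG(2,q)`. -/
abbrev V3 (F : Type*) : Type _ := Fin 3 → F

/-- The symmetric matrix `M_P` of a coordinate vector `y` of a point `P` of `PG(5,q)`. -/
def symMat (y : V6 F) : Matrix (Fin 3) (Fin 3) F :=
  !![y 0, y 1, y 2;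
     y 1, y 3, y 4;
     y 2, y 4, y 5]

/-- The coordinate vector (upper triangular part) of a `3 × 3` matrix. -/
def coords (M : Matrix (Fin 3) (Fin 3) F) : V6 F :=
  ![M 0 0, M 0 1, M 0 2, M 1 1, M 1 2, M 2 2]

lemma symMat_add (y z : V6 F) : symMat (y + z) = symMat y + symMat z := by
  ext i j
  fin_cases i <;> fin_cases j <;> rfl

lemma symMat_smul (t : F) (y : V6 F) : symMat (t • y) = t • symMat y := by
  ext i j
  fin_cases i <;> fin_cases j <;> rfl

lemma coords_add (M N : Matrix (Fin 3) (Fin 3) F) : coords (M + N) = coords M + coords N := by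
  funext i
  fin_cases i <;> rfl

lemma coords_smul (t : F) (M : Matrix (Fin 3) (Fin 3) F) : coords (t • M) = t • coords M := by
  funext i
  fin_cases i <;> rfl

/-! ### The Veronese surface -/

/-- The Veronese map on coordinate vectors. -/
def veroneseVec (u : V3 F) : V6 F :=
  ![u 0 ^ 2, u 0 * u 1, u 0 * u 2, u 1 ^ 2, u 1 * u 2, u 2 ^ 2]

lemma veroneseVec_ne_zero {u : V3 F} (hu : u ≠ 0) : veroneseVec u ≠ 0 := by
  intro h
  apply hu
  have h0 := congrFun h 0
  have h3 := congrFun h 3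
  have h5 := congrFun h 5
  simp [veroneseVec] at h0 h3 h5
  funext i
  fin_cases i
  · exact h0
  · exact h3
  · exact h5

lemma veroneseVec_smul (t : F) (u : V3 F) :
    veroneseVec (t • u) = t ^ 2 • veroneseVec u := by
  funext i
  fin_cases i <;> simp [veroneseVec] <;> ring

/-- The Veronese embedding `ν : PG(2,q) → PG(5,q)`. -/
def veronese : ℙ F (V3 F) → ℙ F (V6 F) :=
  Projectivization.lift
    (fun u => Projectivization.mk F (veroneseVec (u : V3 F)) (veroneseVec_ne_zero u.2))
    (by
      intro a b t h
      rw [Projectivization.mk_eq_mk_iff']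
      exact ⟨t ^ 2, by rw [h, veroneseVec_smul]⟩)

variable (F) in
/-- The Veronese surface, as a set of points of `PG(5,q)`. -/
def veroneseSurface : Set (ℙ F (V6 F)) := Set.range veronese

/-- The image under the Veronese embedding of the line of `PG(2,q)` given by the two-dimensional
subspace `l`; this is a conic of the Veronese surface. -/
def conicOfLine (l : Submodule F (V3 F)) : Set (ℙ F (V6 F)) :=
  veronese '' {p | p.submodule ≤ l}

/-- `C` is a conic `C(P)` of the Veronese surface whose conic plane `⟨C⟩` contains the
point `P`. -/
def IsConicOfPoint (P : ℙ F (V6 F)) (C : Set (ℙ F (V6 F))) : Prop :=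
  (∃ l : Submodule F (V3 F), finrank F l = 2 ∧ C = conicOfLine l) ∧
    P.submodule ≤ ⨆ Q ∈ C, Q.submodule

variable (F) in
/-- The nucleus plane `Z(Y₀, Y₃, Y₅)`. -/
def nucleusPlane : Submodule F (V6 F) :=
  LinearMap.ker (LinearMap.proj 0 : V6 F →ₗ[F] F) ⊓
    LinearMap.ker (LinearMap.proj 3 : V6 F →ₗ[F] F) ⊓
    LinearMap.ker (LinearMap.proj 5 : V6 F →ₗ[F] F)

/-! ### Hyperplanes of `PG(5,q)` and double lines of `PG(2,q)` -/

/-- The hyperplane `Z(a₀₀Y₀ + a₀₁Y₁ + a₀₂Y₂ + a₁₁Y₃ + a₁₂Y₄ + a₂₂Y₅)` attached to the conic with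
coefficients `a = (a₀₀, a₀₁, a₀₂, a₁₁, a₁₂, a₂₂)`. -/
def delta (a : V6 F) : Submodule F (V6 F) :=
  LinearMap.ker (∑ i, a i • (LinearMap.proj i : V6 F →ₗ[F] F))

/-- The coefficients of the quadratic form `(w₀X₀ + w₁X₁ + w₂X₂)²`. -/
def doubleLine (w : V3 F) : V6 F :=
  ![w 0 ^ 2, 2 * w 0 * w 1, 2 * w 0 * w 2, w 1 ^ 2, 2 * w 1 * w 2, w 2 ^ 2]

variable (F) in
/-- The set `H₁` of hyperplanes of `PG(5,q)` corresponding to double lines of `PG(2,q)`. -/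
def doubleLineHyperplanes : Set (Submodule F (V6 F)) :=
  {H | ∃ w : V3 F, w ≠ 0 ∧ H = delta (doubleLine w)}

/-- `H = H(P)`: the hyperplane `H` belongs to `H₁` and contains the conic `C(P)`. -/
def IsHyperplaneOfPoint (P : ℙ F (V6 F)) (H : Submodule F (V6 F)) : Prop :=
  H ∈ doubleLineHyperplanes F ∧ ∃ C, IsConicOfPoint P C ∧ ∀ Q ∈ C, Q.submodule ≤ H

/-- `H = H(π)`: the hyperplane `H` belongs to `H₁` and contains the plane `π`. -/
def IsHyperplaneOfPlane (π H : Submodule F (V6 F)) : Prop :=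
  H ∈ doubleLineHyperplanes F ∧ π ≤ H

/-- `π` is a plane of `PG(5,q)`, disjoint from the Veronese surface, meeting the nucleus plane in
exactly one point `P`, and such that `H(P) = H(π)`. -/
def IsPlaneWithSameHyperplane (π : Submodule F (V6 F)) : Prop :=
  finrank F π = 3 ∧
  (∀ Q ∈ veroneseSurface F, ¬ Q.submodule ≤ π) ∧
  ∃ P : ℙ F (V6 F), π ⊓ nucleusPlane F = P.submodule ∧
    ∃ H : Submodule F (V6 F), IsHyperplaneOfPoint P H ∧ IsHyperplaneOfPlane π H

/-! ### The group `K` and its orbits on planes -/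

/-- The linear map inducing the projectivity `α(φ_A)` of `PG(5,q)`, `M_Q = A M_P Aᵀ`. -/
def alpha (A : GL (Fin 3) F) : V6 F →ₗ[F] V6 F where
  toFun y := coords ((A : Matrix (Fin 3) (Fin 3) F) * symMat y * (A : Matrix (Fin 3) (Fin 3) F)ᵀ)
  map_add' y z := by
    rw [symMat_add, Matrix.mul_add, Matrix.add_mul, coords_add]
  map_smul' t y := by
    rw [symMat_smul, Matrix.mul_smul, Matrix.smul_mul, coords_smul, RingHom.id_apply]

lemma symMat_alpha (A : GL (Fin 3) F) (y : V6 F) :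
    symMat (alpha A y) =
      (A : Matrix (Fin 3) (Fin 3) F) * symMat y * (A : Matrix (Fin 3) (Fin 3) F)ᵀ := by
  ext i j
  fin_cases i <;> fin_cases j <;>
    simp [alpha, coords, symMat, Matrix.mul_apply, Fin.sum_univ_three] <;> ring

/-- The orbit of a subspace of `PG(5,q)` under `K = α(PGL(3,q))`. -/
def KOrbit (π : Submodule F (V6 F)) : Set (Submodule F (V6 F)) :=
  {σ | ∃ A : GL (Fin 3) F, σ = π.map (alpha A)}

/-- `S` is a `K`-orbit of planes of `PG(5,q)`. -/
def IsKOrbitOfPlanes (S : Set (Submodule F (V6 F))) : Prop :=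
  ∃ π : Submodule F (V6 F), finrank F π = 3 ∧ S = KOrbit π

/-! ### Point-orbit distributions -/

/-- The rank of a point of `PG(5,q)`. -/
def pointRank (P : ℙ F (V6 F)) : ℕ := (symMat P.rep).rank

/-- The point-orbit distribution `OD₀(W) = [r₁, r₂ₙ, r₂ₛ, r₃]`. -/
def OD0 (W : Submodule F (V6 F)) : Fin 4 → ℕ :=
  ![{P : ℙ F (V6 F) | P.submodule ≤ W ∧ pointRank P = 1}.ncard,
    {P : ℙ F (V6 F) | P.submodule ≤ W ∧ pointRank P = 2 ∧
      P.submodule ≤ nucleusPlane F}.ncard,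
    {P : ℙ F (V6 F) | P.submodule ≤ W ∧ pointRank P = 2 ∧
      ¬ P.submodule ≤ nucleusPlane F}.ncard,
    {P : ℙ F (V6 F) | P.submodule ≤ W ∧ pointRank P = 3}.ncard]

/-! ### The orbits `Σ₁₈`, `Σ₁₉`, `Σ₂₀` -/

/-- The absolute trace `Tr : F → 𝔽₂`. -/
def absTrace [CharP F 2] (x : F) : ZMod 2 :=
  letI : Algebra (ZMod 2) F := ZMod.algebra F 2
  Algebra.trace (ZMod 2) F x

/-- The subspace of `PG(5,q)` represented by a matrix whose entries are linear forms in
`x, y, z`. -/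
def planeOfMatrix (N : F → F → F → Matrix (Fin 3) (Fin 3) F) : Submodule F (V6 F) :=
  Submodule.span F {v | ∃ x y z : F, symMat v = N x y z}

/-- The parameters `c` of `Σ₁₈`: `Tr(c⁻¹) = Tr(1)` and `c` is non-admissible, that is, the cubic
`X³ + X + c` has no root in `F` (in particular `c ≠ 0`). -/
def IsParam18 [CharP F 2] (c : F) : Prop :=
  absTrace c⁻¹ = absTrace (1 : F) ∧ ∀ x : F, x ^ 3 + x + c ≠ 0

/-- The parameters `(b, c)` of `Σ₂₀`. -/
def IsParam20 [CharP F 2] (b c : F) : Prop :=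
  b ≠ 1 ∧ absTrace (c / (1 + b ^ 2)) = 1

/-- The representative of `Σ₁₈` with parameter `c`. -/
def rep18 (c : F) : Submodule F (V6 F) :=
  planeOfMatrix fun x y z =>
    !![x, y, z;
       y, c * z, x + z;
       z, x + z, 0]

variable (F) in
/-- The representative of `Σ₁₉`. -/
def rep19 : Submodule F (V6 F) :=
  planeOfMatrix fun x y z =>
    !![x, y, 0;
       y, y + z, z;
       0, z, x]

/-- The representative of `Σ₂₀` with parameters `b, c`. -/
def rep20 (b c : F) : Submodule F (V6 F) :=
  planeOfMatrix fun x y z =>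
    !![x, y, b * x;
       y, c * x + y + z, z;
       b * x, z, x]

variable (F) in
/-- The set of all planes that are `K`-equivalent to some representative of `Σ₁₈`. -/
def Sigma18 [CharP F 2] : Set (Submodule F (V6 F)) :=
  {π | ∃ c : F, IsParam18 c ∧ π ∈ KOrbit (rep18 c)}

variable (F) in
/-- The set of all planes that are `K`-equivalent to the representative of `Σ₁₉`. -/
def Sigma19 : Set (Submodule F (V6 F)) := KOrbit (rep19 F)

variable (F) in
/-- The set of all planes that are `K`-equivalent to some representative of `Σ₂₀`. -/
def Sigma20 [CharP F 2] : Set (Submodule F (V6 F)) :=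
  {π | ∃ b c : F, IsParam20 b c ∧ π ∈ KOrbit (rep20 b c)}

end VeronesePlanes

end

open VeronesePlanes

/-! Some element of `K` moves H(π) to Z(Y₅). The condition H(P) = H(π) then says that the conic of P
lies over the line X₂ = 0, so P becomes the point whose only nonzero coordinate is y₁. On such a
plane (y₂, y₄) is a linear function L of (y₀, y₃), and y₁ is free: this is `planeL L`. The plane
misses the Veronese surface exactly when L is invertible, because every element of F is a square
(`exists_eq_planeL`, `veroneseVec_notMem_planeL`).

A block matrix diag(B, 1) acts on (y₂, y₄) by B and, in characteristic two, on (y₀, y₃) by the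
entrywise square B^(2). Hence L may be replaced by any L' with B L = L' B^(2)
(`planeL_mem_KOrbit_of_twistConj`), and the question becomes the classification of
Frobenius-semilinear bijections of F². By descent from the algebraic closure, as in Lang's theorem,
these correspond to the three conjugacy classes of GL(2, 2). The nonzero fixed vectors number 0, 3
or 1, giving Σ₁₈, Σ₁₉ and Σ₂₀. With a fixed vector, L reduces to a unipotent lower triangular
matrix, and the trace of its corner entry decides between the last two classes; without one, the
descent argument `twistConj_of_fixedVecs_eq_empty` shows that there is a single class.

The same fixed vectors count points: each accounts for q points of rank two outside the nucleus
plane (`ncard_rank_two_planeL`). This gives the distributions, and these separate the orbits. -/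

noncomputable section

namespace VeronesePlanes

variable {F : Type*} [Field F]

/-! ### The absolute trace in characteristic two -/

section Trace

variable [CharP F 2]

lemma absTrace_add (x y : F) : absTrace (x + y) = absTrace x + absTrace y := by
  simp [absTrace]

lemma absTrace_sq [Finite F] (x : F) : absTrace (x ^ 2) = absTrace x := by
  let : Algebra (ZMod 2) F := ZMod.algebra F 2
  have h := Algebra.trace_eq_of_algEquiv (FiniteField.frobeniusAlgEquivOfAlgebraic (ZMod 2) F) x
  simpa [absTrace] using h

lemma absTrace_surjective [Finite F] : Function.Surjective (absTrace : F → ZMod 2) := by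
  let : Algebra (ZMod 2) F := ZMod.algebra F 2
  exact Algebra.trace_surjective (ZMod 2) F

lemma absTrace_sq_add_self [Finite F] (t : F) : absTrace (t ^ 2 + t) = 0 := by
  rw [absTrace_add, absTrace_sq, CharTwo.add_self_eq_zero]

/-- An element of absolute trace zero has the form `t² + t`. -/
lemma exists_sq_add_self_eq [Finite F] {x : F} (hx : absTrace x = 0) : ∃ t : F, t ^ 2 + t = x := by
  let : Algebra (ZMod 2) F := ZMod.algebra F 2
  let f : F →ₗ[ZMod 2] F := (frobenius F 2 : F →+ F).toZModLinearMap 2 + LinearMap.id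
  have hf (t : F) : f t = t ^ 2 + t := rfl
  have hker : LinearMap.ker f ≤ Submodule.span (ZMod 2) {(1 : F)} := by
    intro t ht
    rw [LinearMap.mem_ker, hf] at ht
    have h : t * (t + 1) = 0 := by rw [← ht]; ring
    rcases mul_eq_zero.1 h with h | h
    · rw [h]; exact zero_mem _
    · rw [CharTwo.add_eq_zero.1 h]; exact Submodule.mem_span_singleton_self 1
  -- The range of t ↦ t² + t has codimension at most one and lies in the kernel of the trace, which
  -- has codimension exactly one; so the two coincide.
  have h1 : finrank (ZMod 2) (LinearMap.ker f) ≤ 1 :=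
    (Submodule.finrank_mono hker).trans (finrank_span_singleton one_ne_zero).le
  have h2 := f.finrank_range_add_finrank_ker
  have h3 := (Algebra.trace (ZMod 2) F).finrank_range_add_finrank_ker
  rw [LinearMap.range_eq_top.2 (Algebra.trace_surjective (ZMod 2) F), finrank_top,
    finrank_self] at h3
  have hle : LinearMap.range f ≤ LinearMap.ker (Algebra.trace (ZMod 2) F) := by
    rintro _ ⟨t, rfl⟩
    exact absTrace_sq_add_self t
  have heq := Submodule.eq_of_le_of_finrank_le hle (by omega)
  have hx' : x ∈ LinearMap.ker (Algebra.trace (ZMod 2) F) := hx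
  rw [← heq] at hx'
  exact hx'

lemma zmod_two_eq_zero_or_one (a : ZMod 2) : a = 0 ∨ a = 1 := by
  revert a; decide

end Trace

/-! ### Cubics without roots -/

section Cubic

variable [CharP F 2]

/-- With Tr(1) = 1 there is no primitive cube root of unity, so cubing is bijective. Any c outside
the image of x³ + x works: if Tr(c⁻¹) were 0, then c = T + T⁻¹ would be solvable, and T = s³ would
give the root s + s⁻¹. -/
lemma exists_isParam18_of_trace_one [Finite F] (h1 : absTrace (1 : F) = 1) :
    ∃ c : F, IsParam18 c := by
  have hcube : Function.Injective fun x : F => x ^ 3 := by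
    intro a b hab
    simp only at hab
    by_contra hne
    have hb : b ≠ 0 := by
      rintro rfl
      exact hne (by simpa using hab)
    have hab' : a + b ≠ 0 := fun h => hne (CharTwo.add_eq_zero.1 h)
    have h0 : (a + b) * (a ^ 2 + a * b + b ^ 2) = 0 := by
      linear_combination hab + (a ^ 2 * b + a * b ^ 2 + b ^ 3) * CharTwo.two_eq_zero (R := F)
    have h2 := (mul_eq_zero.1 h0).resolve_left hab'
    have h3 : (a / b) ^ 2 + a / b = 1 := by
      field_simp
      linear_combination h2 - b ^ 2 * CharTwo.two_eq_zero (R := F)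
    have h4 := absTrace_sq_add_self (a / b)
    rw [h3, h1] at h4
    exact one_ne_zero h4
  have hsurj := Finite.surjective_of_injective hcube
  have hninj : ¬ Function.Injective fun x : F => x ^ 3 + x := by
    intro h
    have := @h 0 1 (by simp [CharTwo.add_self_eq_zero])
    exact zero_ne_one this
  have hnsurj : ¬ Function.Surjective fun x : F => x ^ 3 + x :=
    fun h => hninj (Finite.injective_iff_surjective.2 h)
  simp only [Function.Surjective, not_forall, not_exists] at hnsurj
  obtain ⟨c, hc⟩ := hnsurj
  have hc0 : c ≠ 0 := by
    rintro rfl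
    exact hc 0 (by simp)
  refine ⟨c, ?_, fun x hx => hc x (CharTwo.add_eq_zero.1 hx)⟩
  rw [h1]
  refine (zmod_two_eq_zero_or_one _).resolve_left fun h => ?_
  -- Passing to c⁻² = t² + t makes T = ct a solution of T² + cT = 1.
  rw [← absTrace_sq] at h
  obtain ⟨t, ht⟩ := exists_sq_add_self_eq h
  obtain ⟨s, hs⟩ := hsurj (c * t)
  simp only at hs
  have hT : (s ^ 3) ^ 2 + c * s ^ 3 = 1 := by
    rw [hs]
    have : (c * t) ^ 2 + c * (c * t) = c ^ 2 * (t ^ 2 + t) := by ring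
    rw [this, ht, inv_pow, mul_inv_cancel₀ (pow_ne_zero 2 hc0)]
  have hs0 : s ≠ 0 := by
    rintro rfl
    simp at hT
  apply hc (s + s⁻¹)
  field_simp
  linear_combination hT + (-c * s ^ 3 + 2 * s ^ 4 + 2 * s ^ 2 + 1) * CharTwo.two_eq_zero (R := F)

/-- Now F contains a primitive cube root of unity, so some T is not a cube, and c = T + T⁻¹ works: a
root of the cubic would produce a cube root of T. -/
lemma exists_isParam18_of_trace_zero [Finite F] (h1 : absTrace (1 : F) = 0) :
    ∃ c : F, IsParam18 c := by
  obtain ⟨w, hw⟩ := exists_sq_add_self_eq h1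
  have hninj : ¬ Function.Injective fun x : F => x ^ 3 := by
    intro h
    have h3 : w ^ 3 = 1 := by
      linear_combination (w - 1) * hw + w * CharTwo.two_eq_zero (R := F) - CharTwo.two_eq_zero (R := F)
    have := @h w 1 (by simpa using h3)
    rw [this, one_pow, CharTwo.add_self_eq_zero] at hw
    exact zero_ne_one hw
  have hnsurj : ¬ Function.Surjective fun x : F => x ^ 3 :=
    fun h => hninj (Finite.injective_iff_surjective.2 h)
  simp only [Function.Surjective, not_forall, not_exists] at hnsurj
  obtain ⟨T, hT⟩ := hnsurj
  have hT0 : T ≠ 0 := by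
    rintro rfl
    exact hT 0 (by simp)
  have hT1 : T + 1 ≠ 0 := fun h => hT 1 (by rw [CharTwo.add_eq_zero.1 h, one_pow])
  have h2 := CharTwo.two_eq_zero (R := F)
  have hc : T + T⁻¹ = (T + 1) ^ 2 / T := by
    field_simp
    linear_combination - T * h2
  refine ⟨T + T⁻¹, ?_, fun x hx => ?_⟩
  · have : (T + T⁻¹)⁻¹ = ((T + 1)⁻¹) ^ 2 + (T + 1)⁻¹ := by
      rw [hc]
      field_simp
      linear_combination -h2
    rw [this, absTrace_sq_add_self, h1]
  · have hx' : T * x ^ 3 + T * x + T ^ 2 + 1 = 0 := by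
      have : T * x ^ 3 + T * x + T ^ 2 + 1 = T * (x ^ 3 + x + (T + T⁻¹)) := by
        field_simp
        ring
      rw [this, hx, mul_zero]
    -- If T = s³ and x = s + s⁻¹, then (Tx + 1)/(x + T) = s; this fraction recovers the cube root
    -- from the root x.
    have key : T * (x + T) ^ 3 = (T * x + 1) ^ 3 := by
      linear_combination (1 + T ^ 2) * hx' +
        (-1 - 2 * T * x - T ^ 2 + T ^ 3 * x - T ^ 3 * x ^ 3) * h2
    have hxT : x + T ≠ 0 := by
      intro h
      rw [h, CharTwo.add_eq_zero.1 h] at key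
      have h4 : (T * T + 1) ^ 3 = ((T + 1) ^ 2) ^ 3 := by
        congr 1
        linear_combination -T * h2
      rw [h4] at key
      exact pow_ne_zero 3 (pow_ne_zero 2 hT1) (by rw [← key]; simp)
    apply hT ((T * x + 1) / (x + T))
    rw [div_pow, ← key]
    field_simp

lemma exists_isParam18 [Finite F] : ∃ c : F, IsParam18 c := by
  rcases zmod_two_eq_zero_or_one (absTrace (1 : F)) with h | h
  · exact exists_isParam18_of_trace_zero h
  · exact exists_isParam18_of_trace_one h

end Cubic

/-! ### Twisted conjugacy of `2 × 2` matrices -/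

/-- The nonzero vectors fixed by the Frobenius-semilinear map with matrix `L`. -/
def fixedVecs (L : Matrix (Fin 2) (Fin 2) F) : Set (Fin 2 → F) :=
  {u | u ≠ 0 ∧ L *ᵥ (fun i => u i ^ 2) = u}

lemma mem_fixedVecs {L : Matrix (Fin 2) (Fin 2) F} {u : Fin 2 → F} :
    u ∈ fixedVecs L ↔ u ≠ 0 ∧ L 0 0 * u 0 ^ 2 + L 0 1 * u 1 ^ 2 = u 0 ∧
      L 1 0 * u 0 ^ 2 + L 1 1 * u 1 ^ 2 = u 1 := by
  simp [fixedVecs, funext_iff, Fin.forall_fin_two]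

section Twist

variable [CharP F 2]

/-- The matrices `L` and `L'` are conjugate up to the Frobenius twist `B L = L' B^(2)`. -/
def TwistConj (L L' : Matrix (Fin 2) (Fin 2) F) : Prop :=
  ∃ B : Matrix (Fin 2) (Fin 2) F, B.det ≠ 0 ∧ B * L = L' * (frobenius F 2).mapMatrix B

lemma det_frobenius_mapMatrix (B : Matrix (Fin 2) (Fin 2) F) :
    ((frobenius F 2).mapMatrix B).det = B.det ^ 2 :=
  (RingHom.map_det (frobenius F 2) B).symm

lemma TwistConj.symm {L L' : Matrix (Fin 2) (Fin 2) F} (h : TwistConj L L') : TwistConj L' L := by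
  obtain ⟨B, hB, h⟩ := h
  have hu : IsUnit B.det := hB.isUnit
  refine ⟨B⁻¹, by simpa [Matrix.det_nonsing_inv] using hB, ?_⟩
  have h1 : (frobenius F 2).mapMatrix B * (frobenius F 2).mapMatrix B⁻¹ = 1 := by
    rw [← map_mul, Matrix.mul_nonsing_inv B hu, map_one]
  calc B⁻¹ * L' = B⁻¹ * (L' * (frobenius F 2).mapMatrix B) * (frobenius F 2).mapMatrix B⁻¹ := by
        rw [Matrix.mul_assoc, Matrix.mul_assoc, h1, Matrix.mul_one]
    _ = L * (frobenius F 2).mapMatrix B⁻¹ := by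
        rw [← h, ← Matrix.mul_assoc, Matrix.nonsing_inv_mul B hu, Matrix.one_mul]

lemma TwistConj.trans {L L' L'' : Matrix (Fin 2) (Fin 2) F} (h : TwistConj L L')
    (h' : TwistConj L' L'') : TwistConj L L'' := by
  obtain ⟨B, hB, h⟩ := h
  obtain ⟨B', hB', h'⟩ := h'
  refine ⟨B' * B, by rw [Matrix.det_mul]; exact mul_ne_zero hB' hB, ?_⟩
  rw [Matrix.mul_assoc, h, ← Matrix.mul_assoc, h', Matrix.mul_assoc, map_mul]

/-- Twisting by a unipotent lower triangular matrix shifts the corner entry by t² + t, so only its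
trace class matters. -/
lemma twistConj_lower {s s' t : F} (h : t ^ 2 + t = s + s') :
    TwistConj !![1, 0; s, 1] !![1, 0; s', 1] := by
  refine ⟨!![1, 0; t, 1], by simp [Matrix.det_fin_two], ?_⟩
  ext i j
  fin_cases i <;> fin_cases j <;> simp [Matrix.mul_apply, Fin.sum_univ_two, frobenius_def]
  linear_combination h + (s - t ^ 2) * CharTwo.two_eq_zero (R := F)

lemma twistConj_lower_diag {r s : F} (hr : r ≠ 0) :
    TwistConj !![r, 0; s, 1] !![1, 0; s / r ^ 2, 1] := by
  refine ⟨!![r, 0; 0, 1], by simp [Matrix.det_fin_two, hr], ?_⟩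
  ext i j
  fin_cases i <;> fin_cases j <;> simp [Matrix.mul_apply, Fin.sum_univ_two, frobenius_def, hr]
  ring

/-- Taking the fixed vector as second basis vector makes the second column (0, 1); a diagonal twist
then turns the remaining diagonal entry r into r · r / r² = 1. -/
lemma exists_twistConj_lower {L : Matrix (Fin 2) (Fin 2) F} (hL : L.det ≠ 0)
    (h : (fixedVecs L).Nonempty) : ∃ s, TwistConj L !![1, 0; s, 1] := by
  obtain ⟨u, hu⟩ := h
  obtain ⟨hu0, h0, h1⟩ := mem_fixedVecs.1 hu
  obtain ⟨C, hC, hCu0, hCu1⟩ : ∃ C : Matrix (Fin 2) (Fin 2) F, C.det ≠ 0 ∧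
      C 0 1 = u 0 ∧ C 1 1 = u 1 := by
    by_cases h : u 0 = 0
    · refine ⟨!![1, u 0; 0, u 1], ?_, rfl, rfl⟩
      simp only [Matrix.det_fin_two_of, mul_zero, one_mul, sub_zero]
      intro h'
      exact hu0 (by ext i; fin_cases i <;> assumption)
    · refine ⟨!![0, u 0; 1, u 1], ?_, rfl, rfl⟩
      simpa [Matrix.det_fin_two_of] using h
  have hCu : IsUnit C.det := hC.isUnit
  set L₁ := C⁻¹ * L * (frobenius F 2).mapMatrix C with hL₁
  have hLL₁ : TwistConj L₁ L := by
    refine ⟨C, hC, ?_⟩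
    rw [hL₁, ← Matrix.mul_assoc, ← Matrix.mul_assoc, Matrix.mul_nonsing_inv C hCu, Matrix.one_mul]
  have hdet : L₁.det ≠ 0 := by
    rw [hL₁, Matrix.det_mul, Matrix.det_mul, det_frobenius_mapMatrix]
    refine mul_ne_zero (mul_ne_zero ?_ hL) (pow_ne_zero 2 hC)
    simpa [Matrix.det_nonsing_inv] using hC
  have hcol : (L * (frobenius F 2).mapMatrix C).col 1 = C.col 1 := by
    ext i
    fin_cases i <;> simp [Matrix.mul_apply, Fin.sum_univ_two, frobenius_def, hCu0, hCu1, h0, h1]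
  have hcol₁ : L₁.col 1 = (1 : Matrix (Fin 2) (Fin 2) F).col 1 := by
    rw [hL₁, Matrix.mul_assoc, ← Matrix.mulVec_single_one, ← Matrix.mulVec_mulVec,
      Matrix.mulVec_single_one, hcol, ← Matrix.mulVec_single_one, Matrix.mulVec_mulVec,
      Matrix.nonsing_inv_mul C hCu, Matrix.mulVec_single_one]
  have h01 : L₁ 0 1 = 0 := by simpa using congrFun hcol₁ 0
  have h11 : L₁ 1 1 = 1 := by simpa using congrFun hcol₁ 1
  have hform : L₁ = !![L₁ 0 0, 0; L₁ 1 0, 1] := by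
    conv_lhs => rw [Matrix.eta_fin_two L₁, h01, h11]
  have h00 : L₁ 0 0 ≠ 0 := by
    rw [hform] at hdet
    simpa [Matrix.det_fin_two_of] using hdet
  refine ⟨L₁ 1 0 / L₁ 0 0 ^ 2, hLL₁.symm.trans ?_⟩
  have := twistConj_lower_diag (s := L₁ 1 0) h00
  rwa [← hform] at this

end Twist

/-! ### Twisted conjugacy of matrices without fixed vectors -/

section Descent

/-- An element fixed by the Frobenius map of a finite field `F` lies in `F`. -/
lemma exists_algebraMap_eq_of_pow_card_eq [Fintype F] {K : Type*} [Field K] [Algebra F K] {x : K}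
    (hx : x ^ Fintype.card F = x) : ∃ y : F, algebraMap F K y = x := by
  open Polynomial in
  have hsplit : ((X ^ Fintype.card F - X : F[X])).Splits := by
    rw [splits_iff_card_roots, FiniteField.roots_X_pow_card_sub_X,
      FiniteField.X_pow_card_sub_X_natDegree_eq F Fintype.one_lt_card]
    rfl
  have hroots := hsplit.roots_map (algebraMap F K)
  have hmem : x ∈ ((Polynomial.X ^ Fintype.card F - Polynomial.X :
      Polynomial F).map (algebraMap F K)).roots := by
    have hne : (Polynomial.X ^ Fintype.card F - Polynomial.X : Polynomial F) ≠ 0 :=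
      FiniteField.X_pow_card_sub_X_ne_zero F Fintype.one_lt_card
    rw [Polynomial.mem_roots (Polynomial.map_ne_zero hne)]
    simp [hx]
  rw [hroots, FiniteField.roots_X_pow_card_sub_X] at hmem
  obtain ⟨y, -, hy⟩ := Multiset.mem_map.1 hmem
  exact ⟨y, hy⟩

/-- Over an algebraically closed field a Frobenius-semilinear bijection has a nonzero fixed
vector. -/
lemma exists_fixedVecs_of_isAlgClosed [CharP F 2] [IsAlgClosed F] {L : Matrix (Fin 2) (Fin 2) F}
    (hL : L.det ≠ 0) : (fixedVecs L).Nonempty := by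
  have h2 := CharTwo.two_eq_zero (R := F)
  rw [Matrix.det_fin_two] at hL
  by_cases hβ : L 0 1 = 0
  · have hδ : L 1 1 ≠ 0 := by
      rintro h
      exact hL (by rw [hβ, h]; ring)
    refine ⟨![0, (L 1 1)⁻¹], mem_fixedVecs.2 ⟨?_, ?_, ?_⟩⟩
    · intro h
      exact inv_ne_zero hδ (by simpa using congrFun h 1)
    · simp [hβ]
    · simp only [Matrix.cons_val_zero, Matrix.cons_val_one]
      field_simp
      ring
  -- For a fixed vector (a, b), the first equation gives b² in terms of a and the second then gives
  -- b. Compatibility of the two, divided by a, is this cubic; its constant term L₀₁ ≠ 0 forces a ≠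
  -- 0.
  · obtain ⟨a, ha⟩ := IsAlgClosed.exists_root
      (Polynomial.C ((L 0 0 * L 1 1 - L 0 1 * L 1 0) ^ 2) * Polynomial.X ^ 3 +
        Polynomial.C 0 * Polynomial.X ^ 2 +
        Polynomial.C (L 1 1 ^ 2 + L 0 0 * L 0 1) * Polynomial.X + Polynomial.C (L 0 1))
      (by rw [Polynomial.degree_cubic (pow_ne_zero 2 hL)]; decide)
    simp only [Polynomial.IsRoot, Polynomial.eval_add, Polynomial.eval_mul, Polynomial.eval_C,
      Polynomial.eval_pow, Polynomial.eval_X] at ha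
    have ha0 : a ≠ 0 := by
      rintro rfl
      exact hβ (by simpa using ha)
    have hb : (L 1 0 * a ^ 2 + L 1 1 * ((a + L 0 0 * a ^ 2) / L 0 1)) ^ 2 =
        (a + L 0 0 * a ^ 2) / L 0 1 := by
      field_simp
      linear_combination ha + (L 1 1 ^ 2 * L 0 0 * a ^ 2 + L 1 0 * L 0 1 * L 1 1 * a ^ 2 +
        2 * L 0 0 * L 0 1 * L 1 0 * L 1 1 * a ^ 3 - L 0 0 * L 0 1 * a - L 0 1) * h2
    refine ⟨![a, L 1 0 * a ^ 2 + L 1 1 * ((a + L 0 0 * a ^ 2) / L 0 1)],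
      mem_fixedVecs.2 ⟨?_, ?_, ?_⟩⟩
    · intro h
      exact ha0 (by simpa using congrFun h 0)
    · simp only [Matrix.cons_val_zero, Matrix.cons_val_one, hb]
      field_simp
      linear_combination L 0 0 * a * h2
    · simp only [Matrix.cons_val_zero, Matrix.cons_val_one, hb]

/-- If the semilinear map of `L` has no nonzero fixed vector over `F`, then it is trivialised by a
matrix over an algebraically closed field on which the Frobenius map of `F` acts by a fixed element of
order three. -/
lemma exists_frame_of_fixedVecs_eq_empty [Fintype F] (K : Type*) [Field K] [Algebra F K]
    [IsAlgClosed K] [CharP K 2] {L : Matrix (Fin 2) (Fin 2) F}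
    (hL : L.det ≠ 0) (h : fixedVecs L = ∅) :
    ∃ C : Matrix (Fin 2) (Fin 2) K, C.det ≠ 0 ∧
      C = L.map (algebraMap F K) * (frobenius K 2).mapMatrix C ∧
      (FiniteField.frobeniusAlgHom F K).mapMatrix C = C * !![0, 1; 1, 1] := by
  set Φ := FiniteField.frobeniusAlgHom F K with hΦ
  set M := L.map (algebraMap F K) with hM
  have hMdet : M.det ≠ 0 := by
    have : M.det = algebraMap F K L.det := (RingHom.map_det (algebraMap F K) L).symm
    rw [this]
    simpa using hL
  have hΦfix (x : K) (hx : Φ x = x) : ∃ y : F, algebraMap F K y = x :=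
    exists_algebraMap_eq_of_pow_card_eq hx
  have hMΦ (i j : Fin 2) : Φ (M i j) = M i j := Φ.commutes _
  -- no nonzero fixed vector is rational
  have hrat (u : Fin 2 → K) (hu : u ∈ fixedVecs M) (hr : ∀ i, Φ (u i) = u i) : False := by
    choose v hv using fun i => hΦfix _ (hr i)
    obtain ⟨hu0, h0, h1⟩ := mem_fixedVecs.1 hu
    have : v ∈ fixedVecs L := by
      refine mem_fixedVecs.2 ⟨?_, ?_, ?_⟩
      · rintro rfl
        exact hu0 (by ext i; rw [← hv]; simp)
      · apply (algebraMap F K).injective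
        simpa [hv, hM] using h0
      · apply (algebraMap F K).injective
        simpa [hv, hM] using h1
    rw [h] at this
    exact this
  obtain ⟨u, hu⟩ := exists_fixedVecs_of_isAlgClosed hMdet
  obtain ⟨hu0, h0, h1⟩ := mem_fixedVecs.1 hu
  have hΦ0 : M 0 0 * Φ (u 0) ^ 2 + M 0 1 * Φ (u 1) ^ 2 = Φ (u 0) := by
    simpa [hMΦ] using congrArg Φ h0
  have hΦ1 : M 1 0 * Φ (u 0) ^ 2 + M 1 1 * Φ (u 1) ^ 2 = Φ (u 1) := by
    simpa [hMΦ] using congrArg Φ h1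
  -- As L has entries in F, the conjugate Φ(u) of a fixed vector is again fixed.
  set C : Matrix (Fin 2) (Fin 2) K := !![u 0, Φ (u 0); u 1, Φ (u 1)] with hC
  have hCM : C = M * (frobenius K 2).mapMatrix C := by
    ext i j
    fin_cases i <;> fin_cases j <;>
      simp [hC, Matrix.mul_apply, Fin.sum_univ_two, frobenius_def, h0, h1, hΦ0, hΦ1]
  have hCdet : C.det ≠ 0 := by
    intro hdet
    obtain ⟨x, hx0, hx⟩ := Matrix.exists_mulVec_eq_zero_iff.2 hdet
    have e0 : u 0 * x 0 + Φ (u 0) * x 1 = 0 := by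
      simpa [hC, Matrix.mulVec, dotProduct] using congrFun hx 0
    have e1 : u 1 * x 0 + Φ (u 1) * x 1 = 0 := by
      simpa [hC, Matrix.mulVec, dotProduct] using congrFun hx 1
    have hx1 : x 1 ≠ 0 := by
      intro hx1
      have hx00 : x 0 ≠ 0 := fun h' => hx0 (by ext i; fin_cases i <;> assumption)
      rw [hx1] at e0 e1
      simp [hx00] at e0 e1
      exact hu0 (by ext i; fin_cases i <;> assumption)
    -- If Φ(u) = l u, both being fixed forces l² = l: l = 0 kills u, and l = 1 makes u rational.
    obtain ⟨l, hl0, hl1⟩ : ∃ l, Φ (u 0) = l * u 0 ∧ Φ (u 1) = l * u 1 := by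
      refine ⟨-x 0 / x 1, ?_, ?_⟩ <;> rw [div_mul_eq_mul_div, eq_div_iff hx1]
      · linear_combination e0
      · linear_combination e1
    rw [hl0, hl1] at hΦ0 hΦ1
    have f0 : (l ^ 2 - l) * u 0 = 0 := by linear_combination hΦ0 - l ^ 2 * h0
    have f1 : (l ^ 2 - l) * u 1 = 0 := by linear_combination hΦ1 - l ^ 2 * h1
    have hl : l * (l - 1) = 0 := by
      by_contra hne
      have hne' : l ^ 2 - l ≠ 0 := fun h' => hne (by rw [← h']; ring)
      exact hu0 (by
        ext i
        fin_cases i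
        · exact (mul_eq_zero.1 f0).resolve_left hne'
        · exact (mul_eq_zero.1 f1).resolve_left hne')
    rcases mul_eq_zero.1 hl with hl | hl
    · rw [hl, zero_mul] at hl0 hl1
      exact hu0 (by
        ext i
        fin_cases i
        · exact (map_eq_zero Φ).1 hl0
        · exact (map_eq_zero Φ).1 hl1)
    · have hl := sub_eq_zero.1 hl
      rw [hl, one_mul] at hl0 hl1
      exact hrat u hu (by
        intro i
        fin_cases i
        · exact hl0
        · exact hl1)
  refine ⟨C, hCdet, hCM, ?_⟩
  have hCu : IsUnit C.det := hCdet.isUnit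
  -- the coordinates of a fixed vector with respect to `C` are `0` or `1`
  set w : Fin 2 → K := fun i => Φ (Φ (u i)) with hw
  set x := C⁻¹ *ᵥ w with hx
  have hCx : C *ᵥ x = w := by
    rw [hx, Matrix.mulVec_mulVec, Matrix.mul_nonsing_inv C hCu, Matrix.one_mulVec]
  have hww : M *ᵥ (fun i => w i ^ 2) = w := by
    ext i
    fin_cases i
    · simpa [hMΦ, hw, Matrix.mulVec, dotProduct] using congrArg Φ hΦ0
    · simpa [hMΦ, hw, Matrix.mulVec, dotProduct] using congrArg Φ hΦ1
  have hxx : (fun i => x i ^ 2) = x := by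
    have e : (fun i => w i ^ 2) = (frobenius K 2).mapMatrix C *ᵥ (fun i => x i ^ 2) := by
      rw [← hCx]
      ext i
      simp [Matrix.mulVec, dotProduct, frobenius_def, CharTwo.add_sq, mul_pow]
    have e2 : C *ᵥ (fun i => x i ^ 2) = C *ᵥ x := by
      rw [hCx, ← hww, e, Matrix.mulVec_mulVec, ← hCM]
    have := congrArg (C⁻¹ *ᵥ ·) e2
    simpa only [Matrix.mulVec_mulVec, Matrix.nonsing_inv_mul C hCu, Matrix.one_mulVec] using this
  have hx01 (i : Fin 2) : x i = 0 ∨ x i = 1 := by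
    have : x i * (x i - 1) = 0 := by linear_combination congrFun hxx i
    rcases mul_eq_zero.1 this with h | h
    · exact Or.inl h
    · exact Or.inr (sub_eq_zero.1 h)
  have w0 : u 0 * x 0 + Φ (u 0) * x 1 = Φ (Φ (u 0)) := by
    simpa [hC, Matrix.mulVec, dotProduct] using congrFun hCx 0
  have w1 : u 1 * x 0 + Φ (u 1) * x 1 = Φ (Φ (u 1)) := by
    simpa [hC, Matrix.mulVec, dotProduct] using congrFun hCx 1
  have hinj : Function.Injective Φ := Φ.injective
  -- Without the first coordinate, Φ²(u) would be 0 or Φ(u), so u would be zero or rational.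
  have hx0 : x 0 = 1 := by
    refine (hx01 0).resolve_left fun hx0 => ?_
    rw [hx0] at w0 w1
    rcases hx01 1 with hx1 | hx1 <;> rw [hx1] at w0 w1 <;> simp at w0 w1
    · exact hu0 (by
        ext i
        fin_cases i
        · simpa using w0.symm
        · simpa using w1.symm)
    · refine hrat u hu fun i => ?_
      fin_cases i
      · exact hinj w0.symm
      · exact hinj w1.symm
  -- Otherwise Φ²(u) = u, and u + Φ(u) would be a rational fixed vector, nonzero since u is not
  -- rational. Hence Φ²(u) = u + Φ(u).
  have hx1 : x 1 = 1 := by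
    refine (hx01 1).resolve_left fun hx1 => ?_
    rw [hx0, hx1] at w0 w1
    simp only [mul_one, mul_zero, add_zero] at w0 w1
    refine hrat (fun i => u i + Φ (u i)) (mem_fixedVecs.2 ⟨?_, ?_, ?_⟩) fun i => ?_
    · intro h'
      refine hrat u hu fun i => ?_
      exact (CharTwo.add_eq_zero.1 (congrFun h' i)).symm
    · simp only [CharTwo.add_sq]
      linear_combination h0 + hΦ0
    · simp only [CharTwo.add_sq]
      linear_combination h1 + hΦ1
    · fin_cases i
      · simp [← w0, add_comm]
      · simp [← w1, add_comm]
  rw [hx0, hx1] at w0 w1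
  ext i j
  fin_cases i <;> fin_cases j <;> simp [hC, Matrix.mul_apply, Fin.sum_univ_two]
  · rw [← w0]; ring
  · rw [← w1]; ring

/-- Any two invertible matrices without nonzero fixed vectors are twisted conjugate. -/
theorem twistConj_of_fixedVecs_eq_empty [CharP F 2] [Finite F] {L L' : Matrix (Fin 2) (Fin 2) F}
    (hL : L.det ≠ 0) (hL' : L'.det ≠ 0) (h : fixedVecs L = ∅) (h' : fixedVecs L' = ∅) :
    TwistConj L L' := by
  cases nonempty_fintype F
  let K := AlgebraicClosure F
  have : CharP K 2 := charP_of_injective_algebraMap (algebraMap F K).injective 2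
  obtain ⟨C, hC, hCM, hCΦ⟩ := exists_frame_of_fixedVecs_eq_empty K hL h
  obtain ⟨C', hC', hCM', hCΦ'⟩ := exists_frame_of_fixedVecs_eq_empty K hL' h'
  set Φ := FiniteField.frobeniusAlgHom F K with hΦ
  have hCu : IsUnit C.det := hC.isUnit
  have hCC : C * C⁻¹ = 1 := Matrix.mul_nonsing_inv C hCu
  have hCC' : C⁻¹ * C = 1 := Matrix.nonsing_inv_mul C hCu
  set B := C' * C⁻¹ with hB
  have hBC : B * C = C' := by rw [hB, Matrix.mul_assoc, hCC', Matrix.mul_one]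
  -- Φ multiplies both frames on the right by the same matrix, which cancels in C' C⁻¹; so B
  -- descends to F.
  have hBΦ : Φ.mapMatrix B = B := by
    have hg : (!![0, 1; 1, 1] : Matrix (Fin 2) (Fin 2) K).det ≠ 0 := by
      simp [Matrix.det_fin_two_of]
    have hdet : IsUnit (C * !![0, 1; 1, 1]).det := by
      rw [Matrix.det_mul]
      exact (mul_ne_zero hC hg).isUnit
    have e : Φ.mapMatrix B * (C * !![0, 1; 1, 1]) = B * (C * !![0, 1; 1, 1]) := by
      rw [← Matrix.mul_assoc B, hBC, ← hCΦ, ← hCΦ', ← map_mul, hBC]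
    have := congrArg (· * (C * !![0, 1; 1, 1])⁻¹) e
    simpa only [Matrix.mul_assoc, Matrix.mul_nonsing_inv _ hdet, Matrix.mul_one] using this
  choose B₀ hB₀ using fun i j => exists_algebraMap_eq_of_pow_card_eq (F := F) (x := B i j)
    (congrFun (congrFun hBΦ i) j)
  have hB₀' : (Matrix.of B₀).map (algebraMap F K) = B := by
    ext i j
    exact hB₀ i j
  refine ⟨Matrix.of B₀, ?_, ?_⟩
  · intro h0
    have : B.det = 0 := by
      rw [← hB₀', show ((Matrix.of B₀).map (algebraMap F K)).det = algebraMap F K (Matrix.of B₀).det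
        from (RingHom.map_det (algebraMap F K) _).symm, h0, map_zero]
    apply hC'
    rw [← hBC, Matrix.det_mul, this, zero_mul]
  · apply Matrix.map_injective (algebraMap F K).injective
    have hσ : ((frobenius F 2).mapMatrix (Matrix.of B₀)).map (algebraMap F K) =
        (frobenius K 2).mapMatrix B := by
      rw [← hB₀']
      ext i j
      simp [frobenius_def]
    have hσC : IsUnit ((frobenius K 2).mapMatrix C).det := by
      rw [det_frobenius_mapMatrix]
      exact (pow_ne_zero 2 hC).isUnit
    beta_reduce
    rw [Matrix.map_mul, Matrix.map_mul, hB₀', hσ]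
    have e : B * L.map (algebraMap F K) * (frobenius K 2).mapMatrix C =
        L'.map (algebraMap F K) * (frobenius K 2).mapMatrix B * (frobenius K 2).mapMatrix C := by
      rw [Matrix.mul_assoc, ← hCM, hBC, Matrix.mul_assoc, ← map_mul, hBC, ← hCM']
    have := congrArg (· * ((frobenius K 2).mapMatrix C)⁻¹) e
    simpa only [Matrix.mul_assoc, Matrix.mul_nonsing_inv _ hσC, Matrix.mul_one] using this

end Descent

/-! ### The action of `GL(3, F)` -/

lemma symMat_injective {R : Type*} :
    Function.Injective (symMat : V6 R → Matrix (Fin 3) (Fin 3) R) := by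
  intro y z h
  have h' (i j : Fin 3) := congrFun (congrFun h i) j
  funext i
  fin_cases i
  exacts [h' 0 0, h' 0 1, h' 0 2, h' 1 1, h' 1 2, h' 2 2]

lemma alpha_one : alpha (1 : GL (Fin 3) F) = LinearMap.id := by
  refine LinearMap.ext fun y => ?_
  apply symMat_injective
  simp [symMat_alpha]

lemma alpha_mul (A B : GL (Fin 3) F) : alpha (A * B) = alpha A ∘ₗ alpha B := by
  refine LinearMap.ext fun y => ?_
  apply symMat_injective
  simp [symMat_alpha, Matrix.mul_assoc]

lemma alpha_inv_comp (A : GL (Fin 3) F) : alpha A⁻¹ ∘ₗ alpha A = LinearMap.id := by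
  rw [← alpha_mul, inv_mul_cancel, alpha_one]

lemma alpha_inv_alpha (A : GL (Fin 3) F) (y : V6 F) : alpha A⁻¹ (alpha A y) = y :=
  LinearMap.congr_fun (alpha_inv_comp A) y

lemma alpha_alpha_inv (A : GL (Fin 3) F) (y : V6 F) : alpha A (alpha A⁻¹ y) = y := by
  simpa using alpha_inv_alpha A⁻¹ y

lemma alpha_injective (A : GL (Fin 3) F) : Function.Injective (alpha A) :=
  Function.LeftInverse.injective (alpha_inv_alpha A)

lemma mem_map_alpha {A : GL (Fin 3) F} {π : Submodule F (V6 F)} {y : V6 F} :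
    y ∈ π.map (alpha A) ↔ alpha A⁻¹ y ∈ π := by
  constructor
  · rintro ⟨x, hx, rfl⟩
    rwa [alpha_inv_alpha]
  · intro h
    exact ⟨_, h, alpha_alpha_inv A y⟩

lemma finrank_map_alpha (A : GL (Fin 3) F) (π : Submodule F (V6 F)) :
    finrank F (π.map (alpha A)) = finrank F π :=
  (Submodule.equivMapOfInjective _ (alpha_injective A) π).finrank_eq.symm

lemma alpha_veroneseVec (A : GL (Fin 3) F) (u : V3 F) :
    alpha A (veroneseVec u) = veroneseVec ((A : Matrix (Fin 3) (Fin 3) F) *ᵥ u) := by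
  funext i
  fin_cases i <;>
    simp [alpha, coords, symMat, veroneseVec, Matrix.mul_apply, Fin.sum_univ_three, Matrix.mulVec,
      dotProduct] <;> ring

lemma self_mem_KOrbit (π : Submodule F (V6 F)) : π ∈ KOrbit π :=
  ⟨1, by rw [alpha_one, Submodule.map_id]⟩

lemma mem_KOrbit_trans {π σ τ : Submodule F (V6 F)} (h : σ ∈ KOrbit π) (h' : τ ∈ KOrbit σ) :
    τ ∈ KOrbit π := by
  obtain ⟨A, rfl⟩ := h
  obtain ⟨B, rfl⟩ := h'
  exact ⟨B * A, by rw [alpha_mul, Submodule.map_comp]⟩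

lemma mem_KOrbit_symm {π σ : Submodule F (V6 F)} (h : σ ∈ KOrbit π) : π ∈ KOrbit σ := by
  obtain ⟨A, rfl⟩ := h
  exact ⟨A⁻¹, by rw [← Submodule.map_comp, alpha_inv_comp, Submodule.map_id]⟩

lemma KOrbit_eq_of_mem {π σ : Submodule F (V6 F)} (h : σ ∈ KOrbit π) : KOrbit σ = KOrbit π :=
  Set.Subset.antisymm (fun _ => mem_KOrbit_trans h) fun _ => mem_KOrbit_trans (mem_KOrbit_symm h)

/-! ### Double-line hyperplanes and the nucleus plane under the group action -/

/-- The value at `w` of the quadratic form whose matrix is the diagonal of `symMat y`. -/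
def diagForm (w : V3 F) (y : V6 F) : F := w 0 ^ 2 * y 0 + w 1 ^ 2 * y 3 + w 2 ^ 2 * y 5

lemma mem_nucleusPlane {y : V6 F} : y ∈ nucleusPlane F ↔ y 0 = 0 ∧ y 3 = 0 ∧ y 5 = 0 := by
  simp [nucleusPlane, and_assoc]

lemma diagForm_single_two (y : V6 F) : diagForm (Pi.single 2 1) y = y 5 := by
  simp [diagForm]

/-- In this form invariance under `K` is visible, since the group only permutes the forms `diagForm
w`. -/
lemma mem_nucleusPlane_iff_diagForm {y : V6 F} :
    y ∈ nucleusPlane F ↔ ∀ w, diagForm w y = 0 := by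
  rw [mem_nucleusPlane]
  constructor
  · rintro ⟨h0, h3, h5⟩ w
    simp [diagForm, h0, h3, h5]
  · intro h
    refine ⟨?_, ?_, ?_⟩
    · simpa [diagForm] using h (Pi.single 0 1)
    · simpa [diagForm] using h (Pi.single 1 1)
    · simpa [diagForm] using h (Pi.single 2 1)

section CharTwo

variable [CharP F 2]

lemma mem_delta_doubleLine {w : V3 F} {y : V6 F} :
    y ∈ delta (doubleLine w) ↔ diagForm w y = 0 := by
  simp [delta, doubleLine, diagForm, Fin.sum_univ_six, CharTwo.two_eq_zero (R := F)]

/-- Off-diagonal entries of a symmetric matrix enter the diagonal of A M Aᵀ with coefficient 2, so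
they disappear. -/
lemma diagForm_alpha (A : GL (Fin 3) F) (w : V3 F) (y : V6 F) :
    diagForm w (alpha A y) = diagForm ((A : Matrix (Fin 3) (Fin 3) F)ᵀ *ᵥ w) y := by
  have h2 := CharTwo.two_eq_zero (R := F)
  simp [diagForm, alpha, coords, symMat, Matrix.mul_apply, Fin.sum_univ_three, Matrix.mulVec,
      dotProduct, CharTwo.add_sq, mul_pow]
  generalize (A : Matrix (Fin 3) (Fin 3) F) = M
  linear_combination (w 0 ^ 2 * (M 0 0 * M 0 1 * y 1 + M 0 0 * M 0 2 * y 2 + M 0 1 * M 0 2 * y 4) +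
    w 1 ^ 2 * (M 1 0 * M 1 1 * y 1 + M 1 0 * M 1 2 * y 2 + M 1 1 * M 1 2 * y 4) +
    w 2 ^ 2 * (M 2 0 * M 2 1 * y 1 + M 2 0 * M 2 2 * y 2 + M 2 1 * M 2 2 * y 4)) * h2

lemma diagForm_veroneseVec (w u : V3 F) : diagForm w (veroneseVec u) = (w ⬝ᵥ u) ^ 2 := by
  simp [diagForm, veroneseVec, dotProduct, Fin.sum_univ_three, CharTwo.add_sq, mul_pow]

lemma alpha_mem_nucleusPlane {A : GL (Fin 3) F} {y : V6 F} :
    alpha A y ∈ nucleusPlane F ↔ y ∈ nucleusPlane F := by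
  have key (A : GL (Fin 3) F) {y : V6 F} (h : y ∈ nucleusPlane F) : alpha A y ∈ nucleusPlane F := by
    rw [mem_nucleusPlane_iff_diagForm] at h ⊢
    intro w
    rw [diagForm_alpha, h]
  exact ⟨fun h => by simpa [alpha_inv_alpha] using key A⁻¹ h, key A⟩

end CharTwo

/-! ### Normal forms of planes -/

/-- The plane of the points with `y₅ = 0` and `(y₂, y₄) = L (y₀, y₃)`. -/
def planeL (L : Matrix (Fin 2) (Fin 2) F) : Submodule F (V6 F) where
  carrier := {y | y 5 = 0 ∧ y 2 = L 0 0 * y 0 + L 0 1 * y 3 ∧ y 4 = L 1 0 * y 0 + L 1 1 * y 3}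
  add_mem' := by
    rintro a b ⟨h1, h2, h3⟩ ⟨h4, h5, h6⟩
    refine ⟨?_, ?_, ?_⟩
    · simp [h1, h4]
    · simp only [Pi.add_apply, h2, h5]; ring
    · simp only [Pi.add_apply, h3, h6]; ring
  zero_mem' := by simp
  smul_mem' := by
    rintro t a ⟨h1, h2, h3⟩
    refine ⟨?_, ?_, ?_⟩
    · simp [h1]
    · simp only [Pi.smul_apply, smul_eq_mul, h2]; ring
    · simp only [Pi.smul_apply, smul_eq_mul, h3]; ring

lemma mem_planeL {L : Matrix (Fin 2) (Fin 2) F} {y : V6 F} : y ∈ planeL L ↔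
    y 5 = 0 ∧ y 2 = L 0 0 * y 0 + L 0 1 * y 3 ∧ y 4 = L 1 0 * y 0 + L 1 1 * y 3 :=
  Iff.rfl

/-- The point of `planeL L` with `(y₀, y₁, y₃) = (x, t, z)`. -/
def planePt (L : Matrix (Fin 2) (Fin 2) F) (x t z : F) : V6 F :=
  ![x, t, L 0 0 * x + L 0 1 * z, z, L 1 0 * x + L 1 1 * z, 0]

lemma planePt_mem (L : Matrix (Fin 2) (Fin 2) F) (x t z : F) : planePt L x t z ∈ planeL L :=
  ⟨rfl, rfl, rfl⟩

lemma planePt_eq {L : Matrix (Fin 2) (Fin 2) F} {y : V6 F} (hy : y ∈ planeL L) :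
    planePt L (y 0) (y 1) (y 3) = y := by
  obtain ⟨h5, h2, h4⟩ := hy
  funext i
  fin_cases i
  exacts [rfl, rfl, h2.symm, rfl, h4.symm, h5.symm]

lemma finrank_planeL (L : Matrix (Fin 2) (Fin 2) F) : finrank F (planeL L) = 3 := by
  let e : planeL L ≃ₗ[F] (Fin 3 → F) :=
    { toFun := fun y => ![y.1 0, y.1 1, y.1 3]
      map_add' := fun a b => by ext i; fin_cases i <;> rfl
      map_smul' := fun t a => by ext i; fin_cases i <;> rfl
      invFun := fun p => ⟨planePt L (p 0) (p 1) (p 2), planePt_mem L _ _ _⟩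
      left_inv := fun y => Subtype.ext (planePt_eq y.2)
      right_inv := fun p => by ext i; fin_cases i <;> rfl }
  rw [e.finrank_eq, finrank_fin_fun]

/-- The matrix diag(B, 1) fixes y₅, acts on (y₂, y₄) by B when y₅ = 0, and acts on (y₀, y₃) by B^(2)
up to multiples of 2y₁. -/
lemma planeL_mem_KOrbit_of_twistConj [CharP F 2] {L L' : Matrix (Fin 2) (Fin 2) F}
    (h : TwistConj L L') : planeL L' ∈ KOrbit (planeL L) := by
  have h2 := CharTwo.two_eq_zero (R := F)
  obtain ⟨B, hB, h⟩ := h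
  have e (i j : Fin 2) : B i 0 * L 0 j + B i 1 * L 1 j =
      L' i 0 * B 0 j ^ 2 + L' i 1 * B 1 j ^ 2 := by
    simpa [Matrix.mul_apply, Fin.sum_univ_two, frobenius_def] using congrFun (congrFun h i) j
  let A : GL (Fin 3) F := Matrix.GeneralLinearGroup.mkOfDetNeZero
    !![B 0 0, B 0 1, 0; B 1 0, B 1 1, 0; 0, 0, 1] (by
      rw [Matrix.det_fin_two] at hB
      simpa [Matrix.det_fin_three] using hB)
  have hA : (A : Matrix (Fin 3) (Fin 3) F) = !![B 0 0, B 0 1, 0; B 1 0, B 1 1, 0; 0, 0, 1] := rfl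
  refine ⟨A, (Submodule.eq_of_le_of_finrank_eq ?_ ?_).symm⟩
  · rintro _ ⟨y, ⟨h5, h2', h4⟩, rfl⟩
    rw [mem_planeL]
    simp [alpha, hA, coords, symMat, Matrix.mul_apply, Fin.sum_univ_three, h5]
    rw [h2', h4]
    constructor
    · linear_combination y 0 * e 0 0 + y 3 * e 0 1 -
        (L' 0 0 * B 0 0 * B 0 1 + L' 0 1 * B 1 0 * B 1 1) * y 1 * h2
    · linear_combination y 0 * e 1 0 + y 3 * e 1 1 -
        (L' 1 0 * B 0 0 * B 0 1 + L' 1 1 * B 1 0 * B 1 1) * y 1 * h2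
  · rw [finrank_map_alpha, finrank_planeL, finrank_planeL]

/-! ### The representatives in normal form -/

lemma rep18_eq_planeL {c : F} (hc : c ≠ 0) : rep18 c = planeL !![0, c⁻¹; 1, c⁻¹] := by
  apply le_antisymm
  · refine Submodule.span_le.2 ?_
    rintro v ⟨x, y, z, h⟩
    have h' (i j : Fin 3) := congrFun (congrFun h i) j
    have h0 : v 0 = x := h' 0 0
    have h2 : v 2 = z := h' 0 2
    have h3 : v 3 = c * z := h' 1 1
    have h4 : v 4 = x + z := h' 1 2
    have h5 : v 5 = 0 := h' 2 2
    refine ⟨h5, ?_, ?_⟩ <;> simp [h0, h2, h3, h4, hc]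
  · rintro v ⟨h5, h2, h4⟩
    refine Submodule.subset_span ⟨v 0, v 1, v 2, ?_⟩
    simp at h2 h4
    have h3 : v 3 = c * v 2 := by rw [h2]; field_simp
    ext i j
    fin_cases i <;> fin_cases j <;> simp [symMat, h5, h2, h4, hc]

/-- The transvection moving the hyperplane of the representatives of `Σ₁₉` and `Σ₂₀` to
`Z(Y₅)`. -/
def transvection20 (F : Type*) [Field F] : GL (Fin 3) F :=
  Matrix.GeneralLinearGroup.mkOfDetNeZero !![1, 0, 0; 0, 1, 0; 1, 0, 1]
    (by simp [Matrix.det_fin_three])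

lemma coe_transvection20 : (transvection20 F : Matrix (Fin 3) (Fin 3) F) =
    !![1, 0, 0; 0, 1, 0; 1, 0, 1] := rfl

lemma alpha_transvection20 (y : V6 F) : alpha (transvection20 F) y =
    ![y 0, y 1, y 0 + y 2, y 3, y 1 + y 4, y 0 + y 2 + (y 2 + y 5)] := by
  funext i
  fin_cases i <;>
    simp [alpha, coe_transvection20, coords, symMat, Matrix.mul_apply, Fin.sum_univ_three]

lemma rep20_eq_map [CharP F 2] (b c : F) :
    rep20 b c = (planeL !![1 + b, 0; c, 1]).map (alpha (transvection20 F)) := by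
  have h2 := CharTwo.two_eq_zero (R := F)
  apply le_antisymm
  · refine Submodule.span_le.2 ?_
    rintro v ⟨x, y, z, h⟩
    -- The transvection is an involution in characteristic two; this is the image of v under it.
    refine ⟨![x, y, (1 + b) * x, c * x + y + z, y + z, 0], ⟨rfl, ?_, ?_⟩, ?_⟩
    · simp
    · simp; linear_combination -c * x * h2
    · apply symMat_injective
      rw [h, alpha_transvection20]
      ext i j
      fin_cases i <;> fin_cases j <;> simp [symMat]
      · linear_combination x * h2
      · linear_combination y * h2
      · linear_combination x * h2
      · linear_combination y * h2
      · linear_combination (x + b * x) * h2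
  · rintro _ ⟨v, ⟨h5, h2', h4⟩, rfl⟩
    simp at h2' h4
    refine Submodule.subset_span ⟨v 0, v 1, v 1 + v 4, ?_⟩
    rw [alpha_transvection20]
    ext i j
    fin_cases i <;> fin_cases j <;> simp [symMat, h5, h2', h4]
    · linear_combination v 0 * h2
    · linear_combination (-v 1 - c * v 0) * h2
    · linear_combination v 0 * h2
    · linear_combination (v 0 + b * v 0) * h2

lemma rep19_eq_map [CharP F 2] :
    rep19 F = (planeL (1 : Matrix (Fin 2) (Fin 2) F)).map (alpha (transvection20 F)) := by
  have h2 := CharTwo.two_eq_zero (R := F)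
  apply le_antisymm
  · refine Submodule.span_le.2 ?_
    rintro v ⟨x, y, z, h⟩
    refine ⟨![x, y, x, y + z, y + z, 0], ⟨rfl, ?_, ?_⟩, ?_⟩
    · simp
    · simp
    · apply symMat_injective
      rw [h, alpha_transvection20]
      ext i j
      fin_cases i <;> fin_cases j <;> simp [symMat]
      · linear_combination x * h2
      · linear_combination y * h2
      · linear_combination x * h2
      · linear_combination y * h2
      · linear_combination x * h2
  · rintro _ ⟨v, ⟨h5, h2', h4⟩, rfl⟩
    simp at h2' h4
    refine Submodule.subset_span ⟨v 0, v 1, v 1 + v 4, ?_⟩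
    rw [alpha_transvection20]
    ext i j
    fin_cases i <;> fin_cases j <;> simp [symMat, h5, h2', h4]
    · linear_combination v 0 * h2
    · linear_combination (-v 1) * h2
    · linear_combination v 0 * h2
    · linear_combination (v 0) * h2

/-! ### Planes with `H(P) = H(π)` -/

lemma mk_submodule_le {V : Type*} [AddCommGroup V] [Module F V] {v : V} (hv : v ≠ 0)
    {W : Submodule F V} : (Projectivization.mk F v hv).submodule ≤ W ↔ v ∈ W := by
  rw [Projectivization.submodule_mk, Submodule.span_singleton_le_iff_mem]

lemma forall_mem_veroneseSurface {p : ℙ F (V6 F) → Prop} :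
    (∀ Q ∈ veroneseSurface F, p Q) ↔
      ∀ u : V3 F, ∀ hu : u ≠ 0, p (.mk F (veroneseVec u) (veroneseVec_ne_zero hu)) := by
  constructor
  · intro h u hu
    exact h _ ⟨.mk F u hu, rfl⟩
  · rintro h _ ⟨P, rfl⟩
    induction P using Projectivization.ind with
    | h u hu => exact h u hu

lemma forall_mem_conicOfLine {l : Submodule F (V3 F)} {p : ℙ F (V6 F) → Prop} :
    (∀ Q ∈ conicOfLine l, p Q) ↔
      ∀ u ∈ l, ∀ hu : u ≠ 0, p (.mk F (veroneseVec u) (veroneseVec_ne_zero hu)) := by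
  constructor
  · intro h u hul hu
    exact h _ ⟨.mk F u hu, (mk_submodule_le hu).2 hul, rfl⟩
  · rintro h _ ⟨P, hP, rfl⟩
    induction P using Projectivization.ind with
    | h u hu => exact h u ((mk_submodule_le hu).1 hP) hu

/-- Such an A carries the double-line hyperplane of w to Z(Y₅), by `diagForm_alpha`. -/
lemma exists_GL_row_two {w : V3 F} (hw : w ≠ 0) :
    ∃ A : GL (Fin 3) F, (A : Matrix (Fin 3) (Fin 3) F) 2 = w := by
  have : w 0 ≠ 0 ∨ w 1 ≠ 0 ∨ w 2 ≠ 0 := by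
    by_contra! h
    exact hw (by ext i; fin_cases i; exacts [h.1, h.2.1, h.2.2])
  have hrow (M : Matrix (Fin 3) (Fin 3) F) (hM : M.det ≠ 0) (hMw : M 2 = w) :
      ∃ A : GL (Fin 3) F, (A : Matrix (Fin 3) (Fin 3) F) 2 = w :=
    ⟨Matrix.GeneralLinearGroup.mkOfDetNeZero M hM, hMw⟩
  rcases this with h | h | h
  · exact hrow !![0, 1, 0; 0, 0, 1; w 0, w 1, w 2] (by simpa [Matrix.det_fin_three] using h)
      (by ext i; fin_cases i <;> rfl)
  · exact hrow !![1, 0, 0; 0, 0, 1; w 0, w 1, w 2] (by simpa [Matrix.det_fin_three] using h)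
      (by ext i; fin_cases i <;> rfl)
  · exact hrow !![1, 0, 0; 0, 1, 0; w 0, w 1, w 2] (by simpa [Matrix.det_fin_three] using h)
      (by ext i; fin_cases i <;> rfl)

lemma exists_sq_eq [CharP F 2] [Finite F] (x : F) : ∃ y : F, y ^ 2 = x :=
  Finite.surjective_of_injective (frobenius_inj F 2) x

lemma planeL_inf_nucleusPlane (L : Matrix (Fin 2) (Fin 2) F) :
    planeL L ⊓ nucleusPlane F = Submodule.span F {Pi.single 1 1} := by
  apply le_antisymm
  · rintro y ⟨⟨h5, h2, h4⟩, hN⟩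
    obtain ⟨h0, h3, -⟩ := mem_nucleusPlane.1 hN
    rw [h0, h3] at h2 h4
    refine Submodule.mem_span_singleton.2 ⟨y 1, ?_⟩
    funext i
    fin_cases i <;> simp [h0, h2, h3, h4, h5]
  · rw [Submodule.span_singleton_le_iff_mem]
    refine ⟨⟨?_, ?_, ?_⟩, mem_nucleusPlane.2 ⟨?_, ?_, ?_⟩⟩ <;> simp

lemma veroneseVec_notMem_planeL {L : Matrix (Fin 2) (Fin 2) F} (hL : L.det ≠ 0) {u : V3 F}
    (hu : u ≠ 0) : veroneseVec u ∉ planeL L := by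
  rintro ⟨h5, h2, h4⟩
  have hu2 : u 2 = 0 := by simpa [veroneseVec] using h5
  have hv : L *ᵥ ![u 0 ^ 2, u 1 ^ 2] = 0 := by
    ext i
    fin_cases i
    · simpa [veroneseVec, hu2, Matrix.mulVec, dotProduct] using h2.symm
    · simpa [veroneseVec, hu2, Matrix.mulVec, dotProduct] using h4.symm
  have hz := Matrix.eq_zero_of_mulVec_eq_zero hL hv
  apply hu
  ext i
  fin_cases i
  · simpa using congrFun hz 0
  · simpa using congrFun hz 1
  · exact hu2

/-- As y₅ = 0, the projection to (y₀, y₃) has kernel σ ∩ π_N, of dimension one, so it is onto. The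
y₁-axis spanning that kernel does not affect y₂ and y₄, which are therefore linear in (y₀, y₃). -/
lemma exists_eq_planeL [CharP F 2] [Finite F] {σ : Submodule F (V6 F)} (hfin : finrank F σ = 3)
    (h5 : ∀ y ∈ σ, y 5 = 0) (hN : σ ⊓ nucleusPlane F = Submodule.span F {Pi.single 1 1})
    (hver : ∀ u : V3 F, u ≠ 0 → veroneseVec u ∉ σ) :
    ∃ L : Matrix (Fin 2) (Fin 2) F, L.det ≠ 0 ∧ σ = planeL L := by
  let d : σ →ₗ[F] F × F := ((LinearMap.proj 0).prod (LinearMap.proj 3)) ∘ₗ σ.subtype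
  have hd (y : σ) : d y = (y.1 0, y.1 3) := rfl
  have hker : (LinearMap.ker d).map σ.subtype = Submodule.span F {Pi.single 1 1} := by
    rw [← hN]
    ext y
    constructor
    · rintro ⟨y, hy, rfl⟩
      have hy := LinearMap.mem_ker.1 hy
      rw [hd, Prod.mk_eq_zero] at hy
      exact ⟨y.2, mem_nucleusPlane.2 ⟨hy.1, hy.2, h5 _ y.2⟩⟩
    · rintro ⟨hy, hy'⟩
      obtain ⟨h0, h3, -⟩ := mem_nucleusPlane.1 hy'
      refine ⟨⟨y, hy⟩, ?_, rfl⟩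
      change d _ = 0
      rw [hd]
      simp [h0, h3]
  have hker1 : finrank F (LinearMap.ker d) = 1 := by
    rw [← Submodule.finrank_map_subtype_eq, hker, finrank_span_singleton]
    simp
  have hrange : LinearMap.range d = ⊤ := by
    apply Submodule.eq_top_of_finrank_eq
    have := d.finrank_range_add_finrank_ker
    rw [finrank_prod, finrank_self]
    omega
  obtain ⟨⟨a, ha⟩, hda⟩ := LinearMap.range_eq_top.1 hrange (1, 0)
  obtain ⟨⟨b, hb⟩, hdb⟩ := LinearMap.range_eq_top.1 hrange (0, 1)
  rw [hd, Prod.mk.injEq] at hda hdb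
  obtain ⟨ha0, ha3⟩ := hda
  obtain ⟨hb0, hb3⟩ := hdb
  simp only at ha0 ha3 hb0 hb3
  have he : (Pi.single 1 1 : V6 F) ∈ σ := by
    have : (Pi.single 1 1 : V6 F) ∈ σ ⊓ nucleusPlane F := by
      rw [hN]
      exact Submodule.mem_span_singleton_self _
    exact this.1
  set L : Matrix (Fin 2) (Fin 2) F := !![a 2, b 2; a 4, b 4] with hL
  have hσL : σ = planeL L := by
    apply le_antisymm
    · intro y hy
      have hy' : y - y 0 • a - y 3 • b ∈ σ ⊓ nucleusPlane F := by
        refine ⟨sub_mem (sub_mem hy (σ.smul_mem _ ha)) (σ.smul_mem _ hb),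
          mem_nucleusPlane.2 ⟨?_, ?_, ?_⟩⟩
        · simp [ha0, hb0]
        · simp [ha3, hb3]
        · simp [h5 _ hy, h5 _ ha, h5 _ hb]
      rw [hN, Submodule.mem_span_singleton] at hy'
      obtain ⟨t, ht⟩ := hy'
      have t2 := congrFun ht 2
      have t4 := congrFun ht 4
      simp at t2 t4
      refine ⟨h5 _ hy, ?_, ?_⟩
      · simp [hL]; linear_combination -t2
      · simp [hL]; linear_combination -t4
    · rintro y ⟨hy5, hy2, hy4⟩
      have : y = y 0 • a + y 3 • b + (y 1 - y 0 * a 1 - y 3 * b 1) • Pi.single 1 1 := by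
        simp [hL] at hy2 hy4
        funext i
        fin_cases i
        · simp [ha0, hb0]
        · simp
        · simp [hy2]; ring
        · simp [ha3, hb3]
        · simp [hy4]; ring
        · simp [hy5, h5 _ ha, h5 _ hb]
      rw [this]
      exact add_mem (add_mem (σ.smul_mem _ ha) (σ.smul_mem _ hb)) (σ.smul_mem _ he)
  refine ⟨L, fun hdet => ?_, hσL⟩
  obtain ⟨v, hv0, hv⟩ := Matrix.exists_mulVec_eq_zero_iff.2 hdet
  -- A kernel vector of L is (r², s²), and then ν(r, s, 0) would lie in σ.
  obtain ⟨r, hr⟩ := exists_sq_eq (v 0)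
  obtain ⟨s, hs⟩ := exists_sq_eq (v 1)
  refine hver ![r, s, 0] ?_ ?_
  · intro h
    have hr0 : r = 0 := by simpa using congrFun h 0
    have hs0 : s = 0 := by simpa using congrFun h 1
    apply hv0
    ext i
    fin_cases i
    · simp [← hr, hr0]
    · simp [← hs, hs0]
  · rw [hσL]
    refine ⟨by simp [veroneseVec], ?_, ?_⟩
    · simpa [veroneseVec, hr, hs, Matrix.mulVec, dotProduct] using (congrFun hv 0).symm
    · simpa [veroneseVec, hr, hs, Matrix.mulVec, dotProduct] using (congrFun hv 1).symm

/-- Every plane with `H(P) = H(π)` is equivalent to some `planeL L` with `L` invertible. -/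
theorem exists_mem_KOrbit_planeL [CharP F 2] [Finite F] {π : Submodule F (V6 F)}
    (h : IsPlaneWithSameHyperplane π) :
    ∃ L : Matrix (Fin 2) (Fin 2) F, L.det ≠ 0 ∧ π ∈ KOrbit (planeL L) := by
  obtain ⟨hfin, hver, P, hP, H, ⟨⟨w, hw, rfl⟩, C, ⟨⟨l, -, rfl⟩, hPC⟩, hCH⟩, -, hπH⟩ := h
  rw [forall_mem_veroneseSurface] at hver
  rw [forall_mem_conicOfLine] at hCH
  simp only [mk_submodule_le] at hver hCH
  obtain ⟨A, hA⟩ := exists_GL_row_two hw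
  have hAw : (A : Matrix (Fin 3) (Fin 3) F)ᵀ *ᵥ Pi.single 2 1 = w := by
    rw [Matrix.mulVec_single_one]
    exact hA
  -- On ν(u) the form of the hyperplane is (w · u)², so C(P) ⊆ H puts the line of C(P) inside w = 0.
  have hlw (u : V3 F) (hu : u ∈ l) : w ⬝ᵥ u = 0 := by
    by_cases hu0 : u = 0
    · simp [hu0]
    · have := mem_delta_doubleLine.1 (hCH u hu hu0)
      rw [diagForm_veroneseVec] at this
      exact pow_eq_zero_iff (two_ne_zero) |>.1 this
  -- After applying A the conic lies over X₂ = 0, so Y₂ and Y₄ vanish on its span. Being also a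
  -- nucleus point, the image of P keeps only its coordinate y₁.
  have hPA : ∀ y ∈ P.submodule, alpha A y 2 = 0 ∧ alpha A y 4 = 0 := by
    let E : Submodule F (V6 F) := (LinearMap.ker (LinearMap.proj 2 : V6 F →ₗ[F] F) ⊓
      LinearMap.ker (LinearMap.proj 4 : V6 F →ₗ[F] F)).comap (alpha A)
    have hle : (⨆ Q ∈ conicOfLine l, Q.submodule) ≤ E := by
      refine iSup₂_le ?_
      rw [forall_mem_conicOfLine]
      intro u hul hu
      rw [mk_submodule_le]
      have h2 : ((A : Matrix (Fin 3) (Fin 3) F) *ᵥ u) 2 = 0 := by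
        rw [Matrix.mulVec, hA, hlw u hul]
      change alpha A (veroneseVec u) ∈
        LinearMap.ker (LinearMap.proj 2 : V6 F →ₗ[F] F) ⊓
          LinearMap.ker (LinearMap.proj 4 : V6 F →ₗ[F] F)
      rw [alpha_veroneseVec]
      simp [veroneseVec, h2]
    exact fun y hy => hle (hPC hy)
  have hPN : P.rep ∈ π ⊓ nucleusPlane F := by
    rw [hP, Projectivization.submodule_eq]
    exact Submodule.mem_span_singleton_self _
  have hPA' := hPA P.rep (by rw [← hP]; exact hPN)
  obtain ⟨g0, g3, g5⟩ := mem_nucleusPlane.1 ((alpha_mem_nucleusPlane (A := A)).2 hPN.2)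
  have hPrep : alpha A P.rep = alpha A P.rep 1 • Pi.single 1 1 := by
    funext i
    fin_cases i <;> simp [g0, g3, g5, hPA'.1, hPA'.2]
  have ht : alpha A P.rep 1 ≠ 0 := by
    intro ht
    rw [ht, zero_smul] at hPrep
    exact P.rep_nonzero (alpha_injective A (by rw [hPrep, map_zero]))
  obtain ⟨L, hL, hσ⟩ := exists_eq_planeL (σ := π.map (alpha A))
    (by rw [finrank_map_alpha, hfin])
    (by
      rintro _ ⟨y, hy, rfl⟩
      rw [← diagForm_single_two (alpha A y), diagForm_alpha, hAw]
      exact mem_delta_doubleLine.1 (hπH hy))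
    (by
      have : nucleusPlane F = (nucleusPlane F).map (alpha A) := by
        ext y
        rw [mem_map_alpha, alpha_mem_nucleusPlane]
      rw [this, ← Submodule.map_inf _ (alpha_injective A), hP, Projectivization.submodule_eq,
        Submodule.map_span, Set.image_singleton, hPrep,
        Submodule.span_singleton_smul_eq ht.isUnit])
    (by
      intro u hu hmem
      rw [mem_map_alpha, alpha_veroneseVec] at hmem
      refine hver _ ?_ hmem
      intro h0
      apply hu
      have := congrArg (A.1 *ᵥ ·) h0
      simpa [Matrix.mulVec_mulVec] using this)
  exact ⟨L, hL, hσ ▸ mem_KOrbit_symm ⟨A, rfl⟩⟩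

/-- Every plane equivalent to some `planeL L` with `L` invertible satisfies `H(P) = H(π)`. -/
theorem isPlaneWithSameHyperplane_of_mem_KOrbit [CharP F 2] {π : Submodule F (V6 F)}
    {L : Matrix (Fin 2) (Fin 2) F} (hL : L.det ≠ 0) (h : π ∈ KOrbit (planeL L)) :
    IsPlaneWithSameHyperplane π := by
  obtain ⟨A, rfl⟩ := h
  have he : (Pi.single 1 1 : V6 F) ≠ 0 := by simp
  have he' : alpha A (Pi.single 1 1) ≠ 0 := fun h => he (alpha_injective A (by rw [h, map_zero]))
  have hAinv : (A : Matrix (Fin 3) (Fin 3) F)⁻¹ * (A : Matrix (Fin 3) (Fin 3) F) = 1 := by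
    rw [← Matrix.coe_units_inv, ← Units.val_mul, inv_mul_cancel, Units.val_one]
  have hmul0 (M : Matrix (Fin 3) (Fin 3) F) (N : Matrix (Fin 3) (Fin 3) F) (hNM : N * M = 1)
      {u : V3 F} (hu : u ≠ 0) : M *ᵥ u ≠ 0 := by
    intro h0
    apply hu
    have := congrArg (N *ᵥ ·) h0
    simpa only [Matrix.mulVec_mulVec, hNM, Matrix.one_mulVec, Matrix.mulVec_zero] using this
  set w : V3 F := ((A⁻¹ : GL (Fin 3) F) : Matrix (Fin 3) (Fin 3) F)ᵀ *ᵥ Pi.single 2 1 with hw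
  have hAw : (A : Matrix (Fin 3) (Fin 3) F)ᵀ *ᵥ w = Pi.single 2 1 := by
    rw [hw, Matrix.mulVec_mulVec, ← Matrix.transpose_mul, ← Units.val_mul, inv_mul_cancel,
      Units.val_one, Matrix.transpose_one, Matrix.one_mulVec]
  have hw0 : w ≠ 0 := by
    intro h
    rw [h, Matrix.mulVec_zero] at hAw
    simpa using congrFun hAw 2
  have hdelta (y : V6 F) : alpha A y ∈ delta (doubleLine w) ↔ y 5 = 0 := by
    rw [mem_delta_doubleLine, diagForm_alpha, hAw, diagForm_single_two]
  let l₀ : Submodule F (V3 F) := LinearMap.ker (LinearMap.proj 2 : V3 F →ₗ[F] F)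
  have hl₀ : finrank F l₀ = 2 := by
    have hr := (LinearMap.proj 2 : V3 F →ₗ[F] F).finrank_range_add_finrank_ker
    rw [LinearMap.range_eq_top.2 (LinearMap.proj_surjective 2), finrank_top, finrank_self,
      finrank_fin_fun] at hr
    have hr' : 1 + finrank F l₀ = 3 := hr
    omega
  have hAinj : Function.Injective (Matrix.mulVecLin (A : Matrix (Fin 3) (Fin 3) F)) := by
    rw [injective_iff_map_eq_zero]
    intro u hu
    by_contra hu0
    exact hmul0 _ _ hAinv hu0 hu
  refine ⟨by rw [finrank_map_alpha, finrank_planeL], ?_, .mk F _ he', ?_, delta (doubleLine w),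
    ⟨⟨w, hw0, rfl⟩, conicOfLine (l₀.map (Matrix.mulVecLin (A : Matrix (Fin 3) (Fin 3) F))),
      ⟨⟨_, ?_, rfl⟩, ?_⟩, ?_⟩, ⟨w, hw0, rfl⟩, ?_⟩
  · rw [forall_mem_veroneseSurface]
    intro u hu
    rw [mk_submodule_le, mem_map_alpha, alpha_veroneseVec]
    refine veroneseVec_notMem_planeL hL (hmul0 _ A ?_ hu)
    rw [← Units.val_mul, mul_inv_cancel, Units.val_one]
  · have : nucleusPlane F = (nucleusPlane F).map (alpha A) := by
      ext y
      rw [mem_map_alpha, alpha_mem_nucleusPlane]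
    rw [this, ← Submodule.map_inf _ (alpha_injective A), planeL_inf_nucleusPlane,
      Submodule.map_span, Set.image_singleton, Projectivization.submodule_mk]
  · rw [← hl₀]
    exact (Submodule.equivMapOfInjective _ hAinj l₀).finrank_eq.symm
  · rw [mk_submodule_le]
    have hmem (u : V3 F) (hu : u ≠ 0) (hu2 : u 2 = 0) : alpha A (veroneseVec u) ∈
        ⨆ Q ∈ conicOfLine (l₀.map (Matrix.mulVecLin (A : Matrix (Fin 3) (Fin 3) F))),
          Q.submodule := by
      rw [alpha_veroneseVec]
      have hAu := hmul0 _ _ hAinv hu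
      rw [← mk_submodule_le (veroneseVec_ne_zero hAu)]
      refine le_iSup₂_of_le _ ?_ le_rfl
      exact ⟨.mk F _ hAu, (mk_submodule_le hAu).2 ⟨u, hu2, rfl⟩, rfl⟩
    -- The nucleus of the conic over X₂ = 0 is a combination of three of its points.
    have e : (Pi.single 1 1 : V6 F) =
        veroneseVec ![1, 1, 0] - veroneseVec ![1, 0, 0] - veroneseVec ![0, 1, 0] := by
      funext i
      fin_cases i <;> simp [veroneseVec]
    rw [e, map_sub, map_sub]
    refine sub_mem (sub_mem (hmem _ ?_ rfl) (hmem _ ?_ rfl)) (hmem _ ?_ rfl)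
    · exact fun h => one_ne_zero (congrFun h 0)
    · exact fun h => one_ne_zero (congrFun h 0)
    · exact fun h => one_ne_zero (congrFun h 1)
  · rw [forall_mem_conicOfLine]
    rintro _ ⟨u, hu, rfl⟩ hu'
    rw [mk_submodule_le, Matrix.mulVecLin_apply, ← alpha_veroneseVec, hdelta]
    have : u 2 = 0 := hu
    simp [veroneseVec, this]
  · rintro _ ⟨y, hy, rfl⟩
    exact (hdelta y).2 hy.1

/-! ### Point-orbit distributions -/

lemma pointRank_mk {v : V6 F} (hv : v ≠ 0) : pointRank (.mk F v hv) = (symMat v).rank := by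
  obtain ⟨a, ha⟩ := Projectivization.exists_smul_eq_mk_rep F v hv
  rw [pointRank, ← ha, Units.smul_def, symMat_smul]
  exact Matrix.rank_smul_of_mem_nonZeroDivisors _ (mem_nonZeroDivisors_of_ne_zero a.ne_zero)

lemma rank_symMat_alpha (A : GL (Fin 3) F) (y : V6 F) :
    (symMat (alpha A y)).rank = (symMat y).rank := by
  have hA : (A : Matrix (Fin 3) (Fin 3) F).det ≠ 0 := A.det_ne_zero
  rw [symMat_alpha, Matrix.rank_mul_eq_left_of_det_ne_zero _ _ (by rwa [Matrix.det_transpose]),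
    Matrix.rank_mul_eq_right_of_det_ne_zero _ _ hA]

lemma ncard_setOf_le_map (A : GL (Fin 3) F) (W : Submodule F (V6 F)) {p : ℙ F (V6 F) → Prop}
    (hp : ∀ P, p (P.map (alpha A) (alpha_injective A)) ↔ p P) :
    {P : ℙ F (V6 F) | P.submodule ≤ W.map (alpha A) ∧ p P}.ncard =
      {P : ℙ F (V6 F) | P.submodule ≤ W ∧ p P}.ncard := by
  have hle {v : V6 F} (hv : v ≠ 0) (hv' : alpha A v ≠ 0) :
      (Projectivization.mk F (alpha A v) hv').submodule ≤ W.map (alpha A) ↔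
        (Projectivization.mk F v hv).submodule ≤ W := by
    rw [mk_submodule_le, mk_submodule_le, mem_map_alpha, alpha_inv_alpha]
  rw [← Set.ncard_image_of_injective {P : ℙ F (V6 F) | P.submodule ≤ W ∧ p P}
    (Projectivization.map_injective (alpha A) (alpha_injective A))]
  congr 1
  ext P
  constructor
  · rintro ⟨hP, hpP⟩
    induction P using Projectivization.ind with
    | h v hv =>
      have hv0 : alpha A⁻¹ v ≠ 0 :=
        fun h => hv (alpha_injective A⁻¹ (by rw [h, map_zero]))
      have hmap : (Projectivization.mk F (alpha A⁻¹ v) hv0).map (alpha A) (alpha_injective A) =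
          .mk F v hv := by
        rw [Projectivization.map_mk]
        congr 1
        exact alpha_alpha_inv A v
      refine ⟨.mk F _ hv0, ⟨?_, ?_⟩, hmap⟩
      · rw [mk_submodule_le] at hP ⊢
        exact mem_map_alpha.1 hP
      · rwa [← hp, hmap]
  · rintro ⟨P, ⟨hP, hpP⟩, rfl⟩
    refine ⟨?_, (hp P).2 hpP⟩
    induction P using Projectivization.ind with
    | h v hv => exact (hle hv _).2 hP

lemma OD0_map_alpha [CharP F 2] (A : GL (Fin 3) F) (W : Submodule F (V6 F)) :
    OD0 (W.map (alpha A)) = OD0 W := by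
  have hrank (P : ℙ F (V6 F)) :
      pointRank (P.map (alpha A) (alpha_injective A)) = pointRank P := by
    induction P using Projectivization.ind with
    | h v hv => rw [Projectivization.map_mk, pointRank_mk, pointRank_mk, rank_symMat_alpha]
  have hnuc (P : ℙ F (V6 F)) : (P.map (alpha A) (alpha_injective A)).submodule ≤ nucleusPlane F ↔
      P.submodule ≤ nucleusPlane F := by
    induction P using Projectivization.ind with
    | h v hv =>
      rw [Projectivization.map_mk, mk_submodule_le, mk_submodule_le, alpha_mem_nucleusPlane]
  simp only [OD0]
  congr 1
  · exact ncard_setOf_le_map A W (by simp [hrank])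
  congr 1
  · exact ncard_setOf_le_map A W (by simp [hrank, hnuc])
  congr 1
  · exact ncard_setOf_le_map A W (by simp [hrank, hnuc])
  congr 1
  · exact ncard_setOf_le_map A W (by simp [hrank])

lemma OD0_eq_of_mem_KOrbit [CharP F 2] {π σ : Submodule F (V6 F)} (h : σ ∈ KOrbit π) :
    OD0 σ = OD0 π := by
  obtain ⟨A, rfl⟩ := h
  exact OD0_map_alpha A π

/-! ### Ranks and point counts in a normal form -/

lemma ncard_setOf_submodule_le [Finite F] (W : Submodule F (V6 F)) :
    {P : ℙ F (V6 F) | P.submodule ≤ W}.ncard =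
      ∑ i ∈ Finset.range (finrank F W), Nat.card F ^ i := by
  rw [← Projectivization.card_of_finrank F W rfl, ← Set.ncard_univ,
    ← Set.ncard_image_of_injective _ (Projectivization.map_injective W.subtype W.injective_subtype)]
  congr 1
  ext P
  constructor
  · intro hP
    induction P using Projectivization.ind with
    | h v hv =>
      have hvW : v ∈ W := (mk_submodule_le hv).1 hP
      exact ⟨.mk F (⟨v, hvW⟩ : W) (by simpa using hv), trivial, rfl⟩
  · rintro ⟨P, -, rfl⟩
    induction P using Projectivization.ind with
    | h v hv =>
      rw [Projectivization.map_mk]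
      exact (mk_submodule_le _).2 v.2

lemma rank_lt_of_det_eq_zero {M : Matrix (Fin 3) (Fin 3) F} (h : M.det = 0) : M.rank < 3 := by
  obtain ⟨v, hv0, hv⟩ := Matrix.exists_mulVec_eq_zero_iff.2 h
  have hker : 0 < finrank F (LinearMap.ker M.mulVecLin) := by
    rw [Module.finrank_pos_iff_exists_ne_zero]
    exact ⟨⟨v, hv⟩, fun h' => hv0 (congrArg Subtype.val h')⟩
  have := M.mulVecLin.finrank_range_add_finrank_ker
  rw [finrank_fin_fun] at this
  rw [Matrix.rank]
  omega

lemma two_le_rank_of_minor {M : Matrix (Fin 3) (Fin 3) F} (r : Fin 2 → Fin 3)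
    (h : (M.submatrix r r).det ≠ 0) : 2 ≤ M.rank := by
  have := Matrix.rank_submatrix_le M r r
  rwa [Matrix.rank_of_det_ne_zero h, Fintype.card_fin] at this

lemma apply_ne_zero_of_det_ne_zero {L : Matrix (Fin 2) (Fin 2) F} (hL : L.det ≠ 0) {x z : F}
    (hxz : ¬(x = 0 ∧ z = 0)) :
    ¬(L 0 0 * x + L 0 1 * z = 0 ∧ L 1 0 * x + L 1 1 * z = 0) := by
  rintro ⟨hf, hg⟩
  have hv : L *ᵥ ![x, z] = 0 := by
    ext i
    fin_cases i
    · simpa [Matrix.mulVec, dotProduct] using hf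
    · simpa [Matrix.mulVec, dotProduct] using hg
  have h0 := Matrix.eq_zero_of_mulVec_eq_zero hL hv
  exact hxz ⟨by simpa using congrFun h0 0, by simpa using congrFun h0 1⟩

/-- If y₀ = y₃ = 0, the minor -y₁² is nonzero. Otherwise (y₂, y₄) ≠ 0 because L is invertible, and
y₅ = 0 makes -y₂² and -y₄² principal minors. -/
lemma two_le_rank_of_mem_planeL {L : Matrix (Fin 2) (Fin 2) F} (hL : L.det ≠ 0) {y : V6 F}
    (hy : y ∈ planeL L) (hy0 : y ≠ 0) : 2 ≤ (symMat y).rank := by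
  obtain ⟨h5, h2, h4⟩ := hy
  by_cases hxz : y 0 = 0 ∧ y 3 = 0
  · rw [hxz.1, hxz.2] at h2 h4
    have h1 : y 1 ≠ 0 := by
      intro h1
      apply hy0
      funext i
      fin_cases i <;> simp [h1, h2, h4, h5, hxz]
    refine two_le_rank_of_minor ![0, 1] ?_
    rw [Matrix.det_fin_two]
    simpa [symMat, hxz] using h1
  · by_cases hf : y 2 = 0
    · have hg : y 4 ≠ 0 := fun hg =>
        apply_ne_zero_of_det_ne_zero hL hxz ⟨by rw [← h2, hf], by rw [← h4, hg]⟩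
      refine two_le_rank_of_minor ![1, 2] ?_
      rw [Matrix.det_fin_two]
      simpa [symMat, h5] using hg
    · refine two_le_rank_of_minor ![0, 2] ?_
      rw [Matrix.det_fin_two]
      simpa [symMat, h5] using hf

lemma det_symMat_of_apply_five [CharP F 2] {y : V6 F} (h5 : y 5 = 0) :
    (symMat y).det = y 3 * y 2 ^ 2 + y 0 * y 4 ^ 2 := by
  simp [Matrix.det_fin_three, symMat, h5]
  linear_combination (y 1 * y 2 * y 4 - y 0 * y 4 ^ 2 - y 3 * y 2 ^ 2) * CharTwo.two_eq_zero (R := F)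

lemma rank_eq_two_iff_of_mem_planeL [CharP F 2] {L : Matrix (Fin 2) (Fin 2) F} (hL : L.det ≠ 0)
    {y : V6 F} (hy : y ∈ planeL L) (hy0 : y ≠ 0) :
    (symMat y).rank = 2 ↔ y 3 * y 2 ^ 2 + y 0 * y 4 ^ 2 = 0 := by
  rw [← det_symMat_of_apply_five hy.1]
  constructor
  · intro h
    by_contra hdet
    rw [Matrix.rank_of_det_ne_zero hdet] at h
    simp at h
  · intro h
    have := rank_lt_of_det_eq_zero h
    have := two_le_rank_of_mem_planeL hL hy hy0
    omega

lemma planePt_sq_ne_zero {L : Matrix (Fin 2) (Fin 2) F} {u : Fin 2 → F} (hu : u ∈ fixedVecs L)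
    (t : F) : planePt L (u 0 ^ 2) t (u 1 ^ 2) ≠ 0 := by
  intro h
  have h0 : u 0 ^ 2 = 0 := congrFun h 0
  have h1 : u 1 ^ 2 = 0 := congrFun h 3
  apply hu.1
  ext i
  fin_cases i
  · simpa using h0
  · simpa using h1

/-- The points of rank two outside the nucleus plane correspond to the fixed vectors of `L`, with
`q` points for each fixed vector. -/
lemma ncard_rank_two_planeL [CharP F 2] [Finite F] {L : Matrix (Fin 2) (Fin 2) F}
    (hL : L.det ≠ 0) :
    {P : ℙ F (V6 F) | P.submodule ≤ planeL L ∧ pointRank P = 2 ∧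
      ¬ P.submodule ≤ nucleusPlane F}.ncard = (fixedVecs L).ncard * Nat.card F := by
  rw [← Set.ncard_univ F, ← Set.ncard_prod]
  symm
  refine Set.ncard_congr
    (fun a ha => .mk F (planePt L (a.1 0 ^ 2) a.2 (a.1 1 ^ 2)) (planePt_sq_ne_zero ha.1 a.2)) ?_ ?_ ?_
  · rintro ⟨u, t⟩ ⟨hu, -⟩
    obtain ⟨hu0, h0, h1⟩ := mem_fixedVecs.1 hu
    refine ⟨(mk_submodule_le _).2 (planePt_mem _ _ _ _), ?_, ?_⟩
    · rw [pointRank_mk, rank_eq_two_iff_of_mem_planeL hL (planePt_mem _ _ _ _)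
        (planePt_sq_ne_zero hu t)]
      simp only [planePt]
      simp [h0, h1]
      linear_combination u 0 ^ 2 * u 1 ^ 2 * CharTwo.two_eq_zero (R := F)
    · rw [mk_submodule_le, mem_nucleusPlane]
      rintro ⟨h0', h3', -⟩
      apply hu0
      ext i
      fin_cases i
      · simpa [planePt] using h0'
      · simpa [planePt] using h3'
  · rintro ⟨u, t⟩ ⟨v, s⟩ ⟨hu, _⟩ ⟨hv, _⟩ h
    change u ∈ fixedVecs L at hu
    change v ∈ fixedVecs L at hv
    obtain ⟨hu0, h0, h1⟩ := mem_fixedVecs.1 hu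
    obtain ⟨hv0, g0, g1⟩ := mem_fixedVecs.1 hv
    obtain ⟨c, hc⟩ := (Projectivization.mk_eq_mk_iff' F _ _ _ _).1 h
    have c0 : c * v 0 ^ 2 = u 0 ^ 2 := congrFun hc 0
    have c1 : c * v 1 ^ 2 = u 1 ^ 2 := congrFun hc 3
    have ct : c * s = t := congrFun hc 1
    have e0 : u 0 = c * v 0 := by
      rw [← h0, ← c0, ← c1]
      linear_combination c * g0
    have e1 : u 1 = c * v 1 := by
      rw [← h1, ← c0, ← c1]
      linear_combination c * g1
    -- Both u = c v and u² = c v² hold entrywise, so c² = c.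
    have hc1 : c = 1 := by
      have hc0 : c ≠ 0 := by
        rintro rfl
        apply hu0
        ext i
        fin_cases i
        · simpa using e0
        · simpa using e1
      rw [e0] at c0
      rw [e1] at c1
      by_contra hne
      have hc2 : c * (c - 1) ≠ 0 := mul_ne_zero hc0 (sub_ne_zero.2 hne)
      have f0 : c * (c - 1) * v 0 ^ 2 = 0 := by linear_combination -c0
      have f1 : c * (c - 1) * v 1 ^ 2 = 0 := by linear_combination -c1
      apply hv0
      ext i
      fin_cases i
      · simpa [hc2] using (mul_eq_zero.1 f0).resolve_left hc2
      · simpa [hc2] using (mul_eq_zero.1 f1).resolve_left hc2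
    rw [hc1, one_mul] at e0 e1 ct
    refine Prod.ext ?_ ct.symm
    ext i
    fin_cases i
    · exact e0
    · exact e1
  · intro P
    induction P using Projectivization.ind with
    | h y hy =>
      rintro ⟨hP, hr, hn⟩
      rw [mk_submodule_le] at hP
      rw [mk_submodule_le, mem_nucleusPlane] at hn
      rw [pointRank_mk, rank_eq_two_iff_of_mem_planeL hL hP hy] at hr
      obtain ⟨h5, h2, h4⟩ := hP
      have hxz : ¬(y 0 = 0 ∧ y 3 = 0) := fun h => hn ⟨h.1, h.2, h5⟩
      obtain ⟨r, hr0⟩ := exists_sq_eq (y 0)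
      obtain ⟨s, hs3⟩ := exists_sq_eq (y 3)
      -- With y₀ = r² and y₃ = s² the determinant is the square of s y₂ + r y₄. Its vanishing makes
      -- L(r², s²) = l (r, s) for some l, and l⁻¹ (r, s) is the fixed vector sought.
      have hcross : s * y 2 = r * y 4 := by
        have : (s * y 2 + r * y 4) ^ 2 = 0 := by
          rw [CharTwo.add_sq, mul_pow, mul_pow, hr0, hs3, hr]
        exact CharTwo.add_eq_zero.1 (pow_eq_zero_iff two_ne_zero |>.1 this)
      have hrs : ¬(r = 0 ∧ s = 0) := by
        rintro ⟨rfl, rfl⟩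
        exact hxz ⟨by rw [← hr0]; simp, by rw [← hs3]; simp⟩
      obtain ⟨l, hl2, hl4⟩ : ∃ l, y 2 = l * r ∧ y 4 = l * s := by
        by_cases hr' : r = 0
        · have hs' : s ≠ 0 := fun h => hrs ⟨hr', h⟩
          refine ⟨y 4 / s, ?_, by field_simp⟩
          rw [hr', zero_mul] at hcross
          rw [hr', mul_zero]
          exact (mul_eq_zero.1 hcross).resolve_left hs'
        · refine ⟨y 2 / r, by field_simp, ?_⟩
          field_simp
          linear_combination -hcross
      have hl : l ≠ 0 := by
        rintro rfl
        exact apply_ne_zero_of_det_ne_zero hL hxz ⟨by rw [← h2, hl2]; simp, by rw [← h4, hl4]; simp⟩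
      have hu : ![l⁻¹ * r, l⁻¹ * s] ∈ fixedVecs L := by
        rw [h2, ← hr0, ← hs3] at hl2
        rw [h4, ← hr0, ← hs3] at hl4
        refine mem_fixedVecs.2 ⟨?_, ?_, ?_⟩
        · intro h
          exact hrs ⟨by simpa [hl] using congrFun h 0, by simpa [hl] using congrFun h 1⟩
        · simp
          field_simp
          linear_combination hl2
        · simp
          field_simp
          linear_combination hl4
      refine ⟨(![l⁻¹ * r, l⁻¹ * s], l⁻¹ ^ 2 * y 1), ⟨hu, trivial⟩, ?_⟩
      rw [Projectivization.mk_eq_mk_iff']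
      refine ⟨l⁻¹ ^ 2, ?_⟩
      funext i
      fin_cases i <;> simp [planePt, h5, h2, h4, ← hr0, ← hs3] <;> ring

/-- The point-orbit distribution of `planeL L`. -/
theorem OD0_planeL [CharP F 2] [Finite F] {L : Matrix (Fin 2) (Fin 2) F} (hL : L.det ≠ 0) :
    OD0 (planeL L) = ![0, 1, (fixedVecs L).ncard * Nat.card F,
      Nat.card F ^ 2 + Nat.card F - (fixedVecs L).ncard * Nat.card F] := by
  have he : (Pi.single 1 1 : V6 F) ≠ 0 := by simp
  have h1 : {P : ℙ F (V6 F) | P.submodule ≤ planeL L ∧ pointRank P = 1} = ∅ := by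
    ext P
    simp only [Set.mem_ofPred_eq, Set.mem_empty_iff_false, iff_false, not_and]
    induction P using Projectivization.ind with
    | h y hy =>
      rw [mk_submodule_le, pointRank_mk]
      intro hyL
      have := two_le_rank_of_mem_planeL hL hyL hy
      omega
  have h2n : {P : ℙ F (V6 F) | P.submodule ≤ planeL L ∧ pointRank P = 2 ∧
      P.submodule ≤ nucleusPlane F} = {.mk F (Pi.single 1 1) he} := by
    ext P
    have hmem : (Pi.single 1 1 : V6 F) ∈ planeL L ⊓ nucleusPlane F := by
      rw [planeL_inf_nucleusPlane]
      exact Submodule.mem_span_singleton_self _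
    constructor
    · rintro ⟨hP, -, hN⟩
      have := le_inf hP hN
      rw [planeL_inf_nucleusPlane] at this
      induction P using Projectivization.ind with
      | h y hy =>
        rw [mk_submodule_le, Submodule.mem_span_singleton] at this
        exact (Projectivization.mk_eq_mk_iff' F _ _ _ _).2 this
    · rintro rfl
      refine ⟨(mk_submodule_le he).2 hmem.1, ?_, (mk_submodule_le he).2 hmem.2⟩
      rw [pointRank_mk, rank_eq_two_iff_of_mem_planeL hL hmem.1 he]
      simp
  have h2s := ncard_rank_two_planeL hL
  have htot := ncard_setOf_submodule_le (planeL L)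
  rw [finrank_planeL, Finset.sum_range_succ, Finset.sum_range_succ, Finset.sum_range_one,
    pow_zero, pow_one] at htot
  set S2n := {P : ℙ F (V6 F) | P.submodule ≤ planeL L ∧ pointRank P = 2 ∧
      P.submodule ≤ nucleusPlane F} with hS2n
  set S2s := {P : ℙ F (V6 F) | P.submodule ≤ planeL L ∧ pointRank P = 2 ∧
      ¬ P.submodule ≤ nucleusPlane F} with hS2s
  set S3 := {P : ℙ F (V6 F) | P.submodule ≤ planeL L ∧ pointRank P = 3} with hS3
  have hc2n : S2n.ncard = 1 := by rw [h2n, Set.ncard_singleton]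
  have hfin (S : Set (ℙ F (V6 F))) : S.Finite := S.toFinite
  have hunion : {P : ℙ F (V6 F) | P.submodule ≤ planeL L} = (S2n ∪ S2s) ∪ S3 := by
    ext P
    simp only [hS2n, hS2s, hS3, Set.mem_union, Set.mem_ofPred_eq]
    have : P.submodule ≤ planeL L → pointRank P = 2 ∨ pointRank P = 3 := by
      induction P using Projectivization.ind with
      | h y hy =>
        rw [mk_submodule_le, pointRank_mk]
        intro hyL
        have := two_le_rank_of_mem_planeL hL hyL hy
        have := (symMat y).rank_le_card_width
        rw [Fintype.card_fin] at this
        omega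
    tauto
  have hd1 : Disjoint S2n S2s := Set.disjoint_left.2 fun P h h' => h'.2.2 h.2.2
  have hd2 : Disjoint (S2n ∪ S2s) S3 := by
    refine Set.disjoint_left.2 fun P h h' => ?_
    have h3 : pointRank P = 3 := h'.2
    rcases h with h | h
    · have := h.2.1; omega
    · have := h.2.1; omega
  rw [hunion, Set.ncard_union_eq hd2 (hfin _) (hfin _), Set.ncard_union_eq hd1 (hfin _) (hfin _),
    hc2n, h2s] at htot
  -- The total q² + q + 1 includes the one nucleus point. Nothing is truncated, since `htot` writes
  -- q² + q as a sum containing the subtracted term.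
  have hc3 : S3.ncard = Nat.card F ^ 2 + Nat.card F - (fixedVecs L).ncard * Nat.card F := by omega
  rw [OD0, h1, ← hS2n, ← hS2s, ← hS3, hc2n, h2s, hc3, Set.ncard_empty]

/-! ### The three orbits -/

lemma ncard_fixedVecs_one : (fixedVecs (1 : Matrix (Fin 2) (Fin 2) F)).ncard = 3 := by
  have : fixedVecs (1 : Matrix (Fin 2) (Fin 2) F) = {![1, 0], ![0, 1], ![1, 1]} := by
    ext u
    simp only [Set.mem_insert_iff, Set.mem_singleton_iff]
    rw [mem_fixedVecs]
    simp only [Matrix.one_apply_eq, one_mul, ne_eq, zero_ne_one, not_false_eq_true,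
      Matrix.one_apply_ne, zero_mul, add_zero, one_ne_zero, zero_add]
    have hsq (x : F) (h : x ^ 2 = x) : x = 0 ∨ x = 1 := by
      have : x * (x - 1) = 0 := by linear_combination h
      rcases mul_eq_zero.1 this with h | h
      · exact Or.inl h
      · exact Or.inr (sub_eq_zero.1 h)
    have hu : u = ![u 0, u 1] := by
      ext i; fin_cases i <;> rfl
    constructor
    · rintro ⟨hu0, h0, h1⟩
      rcases hsq _ h0 with h0 | h0 <;> rcases hsq _ h1 with h1 | h1 <;> rw [h0, h1] at hu
      · exact absurd (by rw [hu]; ext i; fin_cases i <;> rfl) hu0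
      · exact Or.inr (Or.inl hu)
      · exact Or.inl hu
      · exact Or.inr (Or.inr hu)
    · rintro (rfl | rfl | rfl) <;> simp
  rw [this, Set.ncard_eq_three]
  refine ⟨_, _, _, ?_, ?_, ?_, rfl⟩ <;> simp

lemma absTrace_zero [CharP F 2] : absTrace (0 : F) = 0 := by
  simp [absTrace]

/-- The first coordinate is 0 or 1, and 1 would give s = u₁² + u₁, of trace zero. -/
lemma fixedVecs_lower [CharP F 2] [Finite F] {s : F} (hs : absTrace s = 1) :
    fixedVecs !![1, 0; s, 1] = {![0, 1]} := by
  ext u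
  rw [mem_fixedVecs, Set.mem_singleton_iff]
  constructor
  · rintro ⟨hu0, h0, h1⟩
    simp at h0 h1
    have h0' : u 0 = 0 := by
      by_contra hne
      have e0 : u 0 = 1 := mul_left_cancel₀ hne (by linear_combination h0)
      have hs' : s = u 1 ^ 2 + u 1 := by
        rw [e0] at h1
        linear_combination h1 - u 1 ^ 2 * CharTwo.two_eq_zero (R := F)
      rw [hs', absTrace_sq_add_self] at hs
      exact zero_ne_one hs
    have h1' : u 1 ≠ 0 := fun h => hu0 (by ext i; fin_cases i <;> assumption)
    rw [h0'] at h1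
    have e1 : u 1 = 1 := mul_left_cancel₀ h1' (by linear_combination h1)
    ext i
    fin_cases i
    exacts [h0', e1]
  · rintro rfl
    simp

/-- The equations give u₁² = c u₀ and u₁ = u₀² + u₀; eliminating u₁ and dividing by u₀ makes u₀ a
root of the cubic. -/
lemma fixedVecs_companion [CharP F 2] {c : F} (hc : ∀ x : F, x ^ 3 + x + c ≠ 0) :
    fixedVecs !![0, c⁻¹; 1, c⁻¹] = ∅ := by
  have hc0 : c ≠ 0 := by
    rintro rfl
    exact hc 0 (by simp)
  rw [Set.eq_empty_iff_forall_notMem]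
  intro u hu
  obtain ⟨hu0, h0, h1⟩ := mem_fixedVecs.1 hu
  simp at h0 h1
  have h0' : u 1 ^ 2 = c * u 0 := by
    rw [← h0]; field_simp
  rw [h0] at h1
  have hne : u 0 ≠ 0 := by
    intro h
    rw [h] at h1
    exact hu0 (by
      ext i
      fin_cases i
      · exact h
      · simpa using h1.symm)
  apply hc (u 0)
  refine mul_left_cancel₀ hne ?_
  rw [← h1] at h0'
  linear_combination h0' + (c * u 0 - u 0 ^ 3) * CharTwo.two_eq_zero (R := F)

lemma det_lower (r s : F) : (!![r, 0; s, 1] : Matrix (Fin 2) (Fin 2) F).det = r := by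
  simp [Matrix.det_fin_two_of]

lemma det_companion {c : F} (hc : c ≠ 0) :
    (!![0, c⁻¹; 1, c⁻¹] : Matrix (Fin 2) (Fin 2) F).det ≠ 0 := by
  simpa [Matrix.det_fin_two_of] using hc

/-! ### Identification of the three sets with orbits of normal forms -/

lemma Sigma19_eq_KOrbit [CharP F 2] : Sigma19 F = KOrbit (planeL 1) :=
  KOrbit_eq_of_mem ⟨_, rep19_eq_map⟩

lemma mem_Sigma_of_mem_KOrbit [CharP F 2] {π σ : Submodule F (V6 F)} (h : π ∈ KOrbit σ)
    (hσ : σ ∈ Sigma18 F ∨ σ ∈ Sigma19 F ∨ σ ∈ Sigma20 F) :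
    π ∈ Sigma18 F ∨ π ∈ Sigma19 F ∨ π ∈ Sigma20 F := by
  rcases hσ with ⟨c, hc, hσ⟩ | hσ | ⟨b, c, hc, hσ⟩
  · exact Or.inl ⟨c, hc, mem_KOrbit_trans hσ h⟩
  · exact Or.inr (Or.inl (mem_KOrbit_trans hσ h))
  · exact Or.inr (Or.inr ⟨b, c, hc, mem_KOrbit_trans hσ h⟩)

section CharTwo

variable [CharP F 2] [Finite F]

/-- A description without the parameter c: all invertible L without fixed vectors are twisted
conjugate, so one admissible c reaches all of them. -/
lemma mem_Sigma18_iff {π : Submodule F (V6 F)} : π ∈ Sigma18 F ↔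
    ∃ L : Matrix (Fin 2) (Fin 2) F, L.det ≠ 0 ∧ fixedVecs L = ∅ ∧ π ∈ KOrbit (planeL L) := by
  have hc0 {c : F} (hc : IsParam18 c) : c ≠ 0 := by
    rintro rfl
    exact hc.2 0 (by simp)
  constructor
  · rintro ⟨c, hc, hπ⟩
    rw [rep18_eq_planeL (hc0 hc)] at hπ
    exact ⟨_, det_companion (hc0 hc), fixedVecs_companion hc.2, hπ⟩
  · rintro ⟨L, hL, hfix, hπ⟩
    obtain ⟨c, hc⟩ := exists_isParam18 (F := F)
    refine ⟨c, hc, ?_⟩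
    rw [rep18_eq_planeL (hc0 hc)]
    exact mem_KOrbit_trans (planeL_mem_KOrbit_of_twistConj (twistConj_of_fixedVecs_eq_empty
      (det_companion (hc0 hc)) hL (fixedVecs_companion hc.2) hfix)) hπ

lemma exists_Sigma18_eq_KOrbit : ∃ L : Matrix (Fin 2) (Fin 2) F, L.det ≠ 0 ∧ fixedVecs L = ∅ ∧
    Sigma18 F = KOrbit (planeL L) := by
  obtain ⟨c, hc⟩ := exists_isParam18 (F := F)
  have hmem : rep18 c ∈ Sigma18 F := ⟨c, hc, self_mem_KOrbit _⟩
  obtain ⟨L, hL, hfix, -⟩ := mem_Sigma18_iff.1 hmem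
  refine ⟨L, hL, hfix, Set.ext fun π => ⟨fun h => ?_, fun h => mem_Sigma18_iff.2 ⟨L, hL, hfix, h⟩⟩⟩
  obtain ⟨L', hL', hfix', h⟩ := mem_Sigma18_iff.1 h
  exact mem_KOrbit_trans (planeL_mem_KOrbit_of_twistConj
    (twistConj_of_fixedVecs_eq_empty hL hL' hfix hfix')) h

lemma twistConj_lower_of_absTrace {s s' : F} (h : absTrace s = absTrace s') :
    TwistConj !![1, 0; s, 1] !![1, 0; s', 1] := by
  have : absTrace (s + s') = 0 := by rw [absTrace_add, h, CharTwo.add_self_eq_zero]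
  obtain ⟨t, ht⟩ := exists_sq_add_self_eq this
  exact twistConj_lower ht

/-- Normalising the diagonal entry 1 + b turns the corner c into c/(1 + b)² = c/(1 + b²), which has
the same trace as s. -/
lemma rep20_mem_KOrbit {b c : F} (h : IsParam20 b c) {s : F} (hs : absTrace s = 1) :
    rep20 b c ∈ KOrbit (planeL !![1, 0; s, 1]) := by
  have hb : 1 + b ≠ 0 := fun h' => h.1 (CharTwo.add_eq_zero.1 h').symm
  have htr : absTrace s = absTrace (c / (1 + b) ^ 2) := by
    rw [CharTwo.add_sq, one_pow, h.2, hs]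
  exact mem_KOrbit_trans (planeL_mem_KOrbit_of_twistConj
    ((twistConj_lower_of_absTrace htr).trans (twistConj_lower_diag hb).symm)) ⟨_, rep20_eq_map b c⟩

lemma Sigma20_eq_KOrbit {s : F} (hs : absTrace s = 1) :
    Sigma20 F = KOrbit (planeL !![1, 0; s, 1]) := by
  have hparam : IsParam20 (0 : F) s := ⟨zero_ne_one, by simpa using hs⟩
  ext π
  constructor
  · rintro ⟨b, c, h, hπ⟩
    exact mem_KOrbit_trans (rep20_mem_KOrbit h hs) hπ
  · intro h
    exact ⟨0, s, hparam, mem_KOrbit_trans (mem_KOrbit_symm (rep20_mem_KOrbit hparam hs)) h⟩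

/-- Every `planeL L` with `L` invertible belongs to one of the three orbits. -/
lemma planeL_mem_Sigma {L : Matrix (Fin 2) (Fin 2) F} (hL : L.det ≠ 0) :
    planeL L ∈ Sigma18 F ∨ planeL L ∈ Sigma19 F ∨ planeL L ∈ Sigma20 F := by
  rcases (fixedVecs L).eq_empty_or_nonempty with h | h
  · exact Or.inl (mem_Sigma18_iff.2 ⟨L, hL, h, self_mem_KOrbit _⟩)
  · obtain ⟨s, hs⟩ := exists_twistConj_lower hL h
    rcases zmod_two_eq_zero_or_one (absTrace s) with h0 | h1
    · right; left
      rw [Sigma19_eq_KOrbit]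
      have := twistConj_lower_of_absTrace (h0.trans absTrace_zero.symm)
      rw [← Matrix.one_fin_two] at this
      exact planeL_mem_KOrbit_of_twistConj (hs.trans this).symm
    · right; right
      rw [Sigma20_eq_KOrbit h1]
      exact planeL_mem_KOrbit_of_twistConj hs.symm

end CharTwo

end VeronesePlanes

end

/-! ### Assembly of the theorem -/

open VeronesePlanes
theorem mainTheorem4 {F : Type*} [Field F] [Finite F] [CharP F 2]
    (q : ℕ) (hq : Nat.card F = q) :
    -- each of the three sets is a single `K`-orbit of planes, and they are pairwise distinct
    (IsKOrbitOfPlanes (Sigma18 F) ∧ IsKOrbitOfPlanes (Sigma19 F) ∧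
      IsKOrbitOfPlanes (Sigma20 F)) ∧
    (Disjoint (Sigma18 F) (Sigma19 F) ∧ Disjoint (Sigma18 F) (Sigma20 F) ∧
      Disjoint (Sigma19 F) (Sigma20 F)) ∧
    -- the planes in question are exactly the planes in these three orbits
    (∀ π : Submodule F (V6 F), IsPlaneWithSameHyperplane π ↔
      π ∈ Sigma18 F ∨ π ∈ Sigma19 F ∨ π ∈ Sigma20 F) ∧
    -- the point-orbit distributions
    (∀ π ∈ Sigma18 F, OD0 π = ![0, 1, 0, q ^ 2 + q]) ∧
    (∀ π ∈ Sigma19 F, OD0 π = ![0, 1, 3 * q, q ^ 2 - 2 * q]) ∧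
    (∀ π ∈ Sigma20 F, OD0 π = ![0, 1, q, q ^ 2]) := by
  subst hq
  obtain ⟨L, hL, hfix, h18⟩ := exists_Sigma18_eq_KOrbit (F := F)
  obtain ⟨s, hs⟩ := absTrace_surjective (F := F) 1
  have h20 := Sigma20_eq_KOrbit hs
  have h19 := Sigma19_eq_KOrbit (F := F)
  have hdet1 : (1 : Matrix (Fin 2) (Fin 2) F).det ≠ 0 := by simp
  have hdets : (!![1, 0; s, 1] : Matrix (Fin 2) (Fin 2) F).det ≠ 0 := by
    rw [det_lower]
    exact one_ne_zero
  have hq : 2 ≤ Nat.card F := Finite.one_lt_card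
  have hOD18 : ∀ π ∈ Sigma18 F, OD0 π = ![0, 1, 0, Nat.card F ^ 2 + Nat.card F] := by
    intro π hπ
    rw [h18] at hπ
    rw [OD0_eq_of_mem_KOrbit hπ, OD0_planeL hL, hfix]
    simp
  have hOD19 : ∀ π ∈ Sigma19 F,
      OD0 π = ![0, 1, 3 * Nat.card F, Nat.card F ^ 2 - 2 * Nat.card F] := by
    intro π hπ
    rw [h19] at hπ
    rw [OD0_eq_of_mem_KOrbit hπ, OD0_planeL hdet1, ncard_fixedVecs_one]
    congr 4
    omega
  have hOD20 : ∀ π ∈ Sigma20 F, OD0 π = ![0, 1, Nat.card F, Nat.card F ^ 2] := by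
    intro π hπ
    rw [h20] at hπ
    rw [OD0_eq_of_mem_KOrbit hπ, OD0_planeL hdets, fixedVecs_lower hs, Set.ncard_singleton]
    simp
  refine ⟨⟨⟨_, finrank_planeL L, h18⟩, ⟨_, finrank_planeL 1, h19⟩, ⟨_, finrank_planeL _, h20⟩⟩,
    ⟨?_, ?_, ?_⟩, fun π => ⟨fun h => ?_, fun h => ?_⟩, hOD18, hOD19, hOD20⟩
  -- The entries r₂ₛ on the three orbits are 0, 3q and q, pairwise different since q > 0.
  · refine Set.disjoint_left.2 fun π h h' => ?_
    have := congrFun ((hOD18 π h).symm.trans (hOD19 π h')) 2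
    simp at this
    omega
  · refine Set.disjoint_left.2 fun π h h' => ?_
    have := congrFun ((hOD18 π h).symm.trans (hOD20 π h')) 2
    simp at this
    omega
  · refine Set.disjoint_left.2 fun π h h' => ?_
    have := congrFun ((hOD19 π h).symm.trans (hOD20 π h')) 2
    simp at this
    omega
  · obtain ⟨L', hL', hπ⟩ := exists_mem_KOrbit_planeL h
    exact mem_Sigma_of_mem_KOrbit hπ (planeL_mem_Sigma hL')
  · rw [h18, h19, h20] at h
    rcases h with h | h | h
    · exact isPlaneWithSameHyperplane_of_mem_KOrbit hL h
    · exact isPlaneWithSameHyperplane_of_mem_KOrbit hdet1 h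
    · exact isPlaneWithSameHyperplane_of_mem_KOrbit hdets h
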